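/- **Setting.** Variables are linearly ordered ($x_1,x_2,\dots$). A *literal* is $P(\bar x)$ or $\neg P(\bar x)$ with $P/k$ a predicate of arity $k\ge 0$ and $\bar x$ a $k$-tuple of variables; a *clause* is a universally quantified finite disjunction of literals; a *CNF query* $Q$ is a finite conjunction of clauses. So $Q$ contains no constants ($Q$ is *shattered*). $Q$ is *ranked* if the variables of each of its atoms $P(x_{i_1},\dots,x_{i_k})$ satisfy $i_1<\dots<i_k$. A tuple-independent probabilistic database (PDB) over a domain $D$ of size $n\ge 1$ assigns a probability in $[0,1]$ to every ground atom over $D$; $\Pr(Q)$ is the sum, over all worlds (sets of true ground atoms over $D$ of the predicates of $Q$) satisfying $Q$, of the product of the probabilities of the ground literals true in that world. Implication and equivalence are over nonempty domains. A *prime implicate* of $Q$ is a clause $C$ implied by $Q$ such that every clause $C'$ with $Q\Rightarrow C'\Rightarrow C$ is equivalent to $C$ and has at least as many literals. A *connected component* of $C$ is a minimal nonempty set of its literals sharing no variable with the rest of $C$. A clause $D$ *subsumes* $C$ if $D\sigma\subseteq C$ for some substitution $\sigma$ of variables by variables, and $|D|\le|C|$. *Separator variables* for $Q=\bigwedge_i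 C_i$ are variables $x_i$ such that $x_i$ occurs in every atom of $C_i$, at a position that depends only on the predicate of the atom (the same for all clauses). **Algorithm $\mathrm{Lift}^R$**, on a query $Q$ and a PDB with domain $D$. First simplify $Q$: remove redundant clauses and redundant literals until none is left. 0. If $Q$ is the empty conjunction, return $1$; if $Q$ contains the empty clause, return $0$; if $Q$ is a single ground literal, return its probability. 1. Take all ranked prime implicates (up to equivalence) that have more than one connected component and each of whose components subsumes some clause of $Q$. For each way of choosing one component of each of them, conjoin the chosen components to $Q$; simplify the resulting CNFs and discard redundant ones, obtaining $Q\equiv Q_1\vee\dots\vee Q_m$. 2. If $m>1$ and $\{Q_1,\dots,Q_m\}$ can be partitioned into two nonempty parts without common predicates, with disjunctions $Q',Q''$ (rewritten as CNFs), return $1-(1-\Pr(Q'))(1-\Pr(Q''))$. 3. If $m>1$ and there is no such partition, return $\sum_{K}c_K\Pr(K)$, where $K$ runs over representatives of the equivalence classes of the conjunctions $\bigwedge_{i\in s}Q_i$, $\emptyset\ne s\subseteq\{1,\dots,m\}$, and $c_K=\sum_{s:\,\bigwedge_{i\in s}Q_i\equiv K}(-1)^{|s|+1}$; the terms with $c_K=0$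 are cancelled, i.e. not computed. 4. (If $m=1$.) Take the CNF $Q=C_1\wedge\dots\wedge C_r$. 5. If its clauses can be partitioned into two nonempty parts $Q',Q''$ without common predicates, return $\Pr(Q')\cdot\Pr(Q'')$. 6. If $Q$ has separator variables $x_1,\dots,x_r$, return $\prod_{a\in D}\Pr(C_1[a/x_1]\wedge\dots\wedge C_r[a/x_r])$, where the instantiated atoms of each predicate are regarded as atoms of a predicate of arity one less. Otherwise FAIL. All probabilities on the right-hand sides are computed recursively; a call fails as soon as one of its recursive calls fails. The choices left open (which simplification, representatives, partition, separator variables) are resolved by an arbitrary rule depending on the query only. Running time is data complexity with unit costs: each call, database look-up and arithmetic operation on real numbers takes one step, and each call takes in addition, for processing its query, a number of steps which is an arbitrary function of that query. **Theorem.** Let $Q$ be a ranked, shattered CNF query and let $k$ be the largest arity of a predicate of $Q$. For every way of resolving the open choices, one of the following holds: 1. $\mathrm{Lift}^R$ fails on $Q$: for every domain of size $n\ge1$ and every PDB over it, it halts with answer FAIL; or 2. there is a constant $c$ (depending on $Q$ and on the way the query processing is done, but not on $n$ or the PDB) such that for every $n\ge 1$ and every PDB over a domain of size $n$, $\mathrm{Lift}^R$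 halts after at most $c\,n^k$ steps and returns $\Pr(Q)$. -/

import Mathlib

namespace LiftR

/-! ## Queries -/

/-- A constant-free literal `P(x₁, …, x_k)` or `¬P(x₁, …, x_k)`.  Variables are natural numbers.
A predicate is a name together with an arity, the number of arguments of the literal. -/
structure Literal (ρ : Type*) where
  pos : Bool
  rel : ρ
  args : List ℕ
deriving DecidableEq

/-- A clause: the universally quantified disjunction of its literals. -/
abbrev Clause (ρ : Type*) := Finset (Literal ρ)

/-- A CNF query: the conjunction of its clauses. -/
abbrev CNF (ρ : Type*) := Finset (Clause ρ)

variable {ρ : Type*}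

def Literal.vars (l : Literal ρ) : Finset ℕ := l.args.toFinset

/-- The predicate symbol `P/k` of a literal. -/
def Literal.symbol (l : Literal ρ) : ρ × ℕ := (l.rel, l.args.length)

def Literal.rename (σ : ℕ → ℕ) (l : Literal ρ) : Literal ρ := ⟨l.pos, l.rel, l.args.map σ⟩

def Clause.vars (C : Clause ρ) : Finset ℕ := C.biUnion Literal.vars

def Clause.rename [DecidableEq ρ] (σ : ℕ → ℕ) (C : Clause ρ) : Clause ρ :=
  C.image (Literal.rename σ)

def CNF.symbols [DecidableEq ρ] (Q : CNF ρ) : Finset (ρ × ℕ) :=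
  Q.biUnion fun C => C.image Literal.symbol

/-- The largest arity of a predicate symbol of `Q`. -/
def CNF.maxArity [DecidableEq ρ] (Q : CNF ρ) : ℕ := Q.symbols.sup Prod.snd

/-- The arguments of every literal are strictly increasing in the order of the variables. -/
def Clause.Ranked (C : Clause ρ) : Prop := ∀ l ∈ C, l.args.Pairwise (· < ·)

def CNF.Ranked (Q : CNF ρ) : Prop := ∀ C ∈ Q, Clause.Ranked C

/-! ## Semantics -/

/-- A world over the domain `D`: which ground atoms are true. -/
abbrev World (ρ : Type*) (D : Type*) := ρ → List D → Prop

def Literal.Holds {D : Type*} (I : World ρ D) (v : ℕ → D) (l : Literal ρ) : Prop :=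
  if l.pos then I l.rel (l.args.map v) else ¬ I l.rel (l.args.map v)

def Clause.Holds {D : Type*} (I : World ρ D) (C : Clause ρ) : Prop :=
  ∀ v : ℕ → D, ∃ l ∈ C, l.Holds I v

def CNF.Holds {D : Type*} (I : World ρ D) (Q : CNF ρ) : Prop :=
  ∀ C ∈ Q, Clause.Holds I C

/-- Logical implication (over all nonempty domains). -/
def Entails (Q Q' : CNF ρ) : Prop :=
  ∀ (D : Type) [Nonempty D] (I : World ρ D), Q.Holds I → Q'.Holds I

/-- Logical equivalence. -/
def Equivalent (Q Q' : CNF ρ) : Prop := Entails Q Q' ∧ Entails Q' Q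

/-! ## Probabilistic databases -/

/-- A tuple-independent probabilistic database over the domain `Fin n`. -/
structure PDB (ρ : Type*) (n : ℕ) where
  prob : ρ → List (Fin n) → ℝ
  nonneg : ∀ R t, 0 ≤ prob R t
  le_one : ∀ R t, prob R t ≤ 1

/-- All ground atoms over the domain `Fin n` of the predicate symbols of `Q`. -/
def groundAtoms [DecidableEq ρ] (n : ℕ) (Q : CNF ρ) : Finset (ρ × List (Fin n)) :=
  Q.symbols.biUnion fun s =>
    (Finset.univ : Finset (Fin s.2 → Fin n)).image fun t => (s.1, List.ofFn t)

open Classical in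
/-- `Pr(Q)`: the sum over all worlds (given by their sets `I` of true ground atoms) satisfying `Q`
of the product of the probabilities of their ground literals. -/
noncomputable def Pr [DecidableEq ρ] {n : ℕ} (P : PDB ρ n) (Q : CNF ρ) : ℝ :=
  ∑ I ∈ (groundAtoms n Q).powerset,
    if Q.Holds (fun R t => (R, t) ∈ I) then
      ∏ g ∈ groundAtoms n Q, (if g ∈ I then P.prob g.1 g.2 else 1 - P.prob g.1 g.2)
    else 0

/-- The probability of the ground literal `l`, a literal without arguments. -/
def PDB.literal {n : ℕ} (P : PDB ρ n) (l : Literal ρ) : ℝ :=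
  if l.pos then P.prob l.rel [] else 1 - P.prob l.rel []

/-! ## Prime implicates and union-CNF -/

/-- A clause entailed by `Q`. -/
def IsImplicate (Q : CNF ρ) (C : Clause ρ) : Prop := Entails Q {C}

/-- `C` is an implicate of `Q`, and no other implicate of `Q` implies `C`, where the implicates
that are equivalent to `C` and not shorter than `C` are not counted as other ones. -/
def IsPrimeImplicate (Q : CNF ρ) (C : Clause ρ) : Prop :=
  IsImplicate Q C ∧
    ∀ C' : Clause ρ, IsImplicate Q C' → Entails {C'} {C} → Entails {C} {C'} ∧ C.card ≤ C'.card

/-- `S` is a nonempty set of literals of `C` sharing no variables with the rest of `C`. -/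
def IsSeparated (C S : Clause ρ) : Prop :=
  S ⊆ C ∧ S.Nonempty ∧ ∀ l ∈ S, ∀ l' ∈ C, l' ∉ S → Disjoint l.vars l'.vars

/-- A connected component of `C`: a minimal separated set of literals. -/
def IsComponent (C S : Clause ρ) : Prop :=
  IsSeparated C S ∧ ∀ T, IsSeparated C T → T ⊆ S → T = S

open Classical in
noncomputable def components (C : Clause ρ) : Finset (Clause ρ) :=
  C.powerset.filter (IsComponent C)

/-- `D` subsumes `C`: some instance of `D` is contained in `C`, and `D` is not longer than `C`. -/
def Subsumes [DecidableEq ρ] (D C : Clause ρ) : Prop :=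
  (∃ σ : ℕ → ℕ, Clause.rename σ D ⊆ C) ∧ D.card ≤ C.card

/-- The prime implicates used to write `Q` as a union: the disconnected (ranked) ones each of whose
connected components subsumes some clause of `Q`. -/
def IsSplitting [DecidableEq ρ] (Q : CNF ρ) (C : Clause ρ) : Prop :=
  C.Ranked ∧ IsPrimeImplicate Q C ∧ 1 < (components C).card ∧
    ∀ D ∈ components C, ∃ C' ∈ Q, Subsumes D C'

/-- Distributivity: for implicates `𝒞` of `Q`, the CNFs `Q ∧ ⋀_{C ∈ 𝒞} D_C`, one for each way to
choose a component `D_C` of each `C ∈ 𝒞`.  Their disjunction is equivalent to `Q`. -/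
noncomputable def distribute [DecidableEq ρ] (𝒞 : Finset (Clause ρ)) (Q : CNF ρ) :
    Finset (CNF ρ) :=
  (𝒞.pi fun C => components C).image fun f => Q ∪ 𝒞.attach.image fun C => f C.1 C.2

/-- `R` is obtained from `Q` by removing redundant clauses and redundant literals, until none is
left.  For an unsatisfiable `Q` it is `{∅}`, for a valid `Q` it is `∅`. -/
def IsSimplification [DecidableEq ρ] (Q R : CNF ρ) : Prop :=
  Equivalent Q R ∧ (∀ C ∈ R, ∃ C' ∈ Q, C ⊆ C') ∧
    (∀ C ∈ R, ¬ Entails (R.erase C) {C}) ∧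
    ∀ C ∈ R, ∀ l ∈ C, ¬ IsImplicate R (C.erase l)

/-- `U = [Q₁, …, Q_m]` is a union-CNF `Q₁ ∨ ⋯ ∨ Q_m` of `Q`: it arises by distributivity from all
disconnected prime implicates of the kind above (up to equivalence), after simplifying the
resulting CNFs and removing the redundant ones among them. -/
def IsUnionCNF [DecidableEq ρ] (simplify : CNF ρ → CNF ρ) (Q : CNF ρ) (U : List (CNF ρ)) : Prop :=
  ∃ 𝒞 : Finset (Clause ρ),
    (∀ C ∈ 𝒞, IsSplitting Q C) ∧
    (∀ C, IsSplitting Q C → ∃ C' ∈ 𝒞, Equivalent {C} {C'}) ∧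
    (∀ q ∈ U, ∃ d ∈ distribute 𝒞 Q, q = simplify d) ∧
    (∀ d ∈ distribute 𝒞 Q, ∃ q ∈ U, Entails d q) ∧
    U.Pairwise fun q q' => ¬ Entails q q' ∧ ¬ Entails q' q

/-! ## The rules of the algorithm -/

/-- A partition of the union `U` into two nonempty parts without common predicate symbols. -/
def IsUnionPartition [DecidableEq ρ] (U : List (CNF ρ)) (p : List (CNF ρ) × List (CNF ρ)) : Prop :=
  p.1 ≠ [] ∧ p.2 ≠ [] ∧ U.Perm (p.1 ++ p.2) ∧
    ∀ q ∈ p.1, ∀ q' ∈ p.2, Disjoint q.symbols q'.symbols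

/-- A partition of the clauses of `Q` into two nonempty sets without common predicate symbols. -/
def IsClausePartition [DecidableEq ρ] (Q : CNF ρ) (p : CNF ρ × CNF ρ) : Prop :=
  p.1.Nonempty ∧ p.2.Nonempty ∧ p.1 ∪ p.2 = Q ∧ Disjoint p.1.symbols p.2.symbols

/-- The CNF of `q ∨ r`, with the variables of `r` renamed apart (by an order-preserving shift). -/
def CNF.or [DecidableEq ρ] (q r : CNF ρ) : CNF ρ :=
  Finset.image₂ (fun C D : Clause ρ => C ∪ D.rename (· + (C.vars.sup id + 1))) q r

/-- The CNF of a disjunction of CNFs. -/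
def disjunction [DecidableEq ρ] (U : List (CNF ρ)) : CNF ρ := U.foldr CNF.or {∅}

/-- The conjunction `⋀_{i ∈ s} Q_i` of members of `U = [Q₁, …, Q_m]`. -/
def conjunction [DecidableEq ρ] (U : List (CNF ρ)) (s : Finset (Fin U.length)) : CNF ρ :=
  s.biUnion fun i => U.get i

/-- `T` lists one representative of each equivalence class of the conjunctions that occur in the
inclusion/exclusion formula for `U`. -/
def IsTermList [DecidableEq ρ] (U T : List (CNF ρ)) : Prop :=
  (∀ q ∈ T, ∃ s : Finset (Fin U.length), s.Nonempty ∧ q = conjunction U s) ∧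
    (∀ s : Finset (Fin U.length), s.Nonempty → ∃ q ∈ T, Equivalent (conjunction U s) q) ∧
    T.Pairwise fun q q' => ¬ Equivalent q q'

open Classical in
/-- The total coefficient, in the inclusion/exclusion formula for `U`, of the conjunctions that are
equivalent to `q`. -/
noncomputable def coefficient [DecidableEq ρ] (U : List (CNF ρ)) (q : CNF ρ) : ℤ :=
  ∑ s : Finset (Fin U.length),
    if s.Nonempty ∧ Equivalent (conjunction U s) q then (-1) ^ (s.card + 1) else 0

/-- A choice of separator variables for `Q`: the variable `sep.1 C` of the clause `C` occurs in each
literal of `C`, for literals of the predicate `R/k` at position `sep.2 R k`. -/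
def IsSeparator (Q : CNF ρ) (sep : (Clause ρ → ℕ) × (ρ → ℕ → ℕ)) : Prop :=
  ∀ C ∈ Q, ∀ l ∈ C, l.args[sep.2 l.rel l.args.length]? = some (sep.1 C)

/-- The query `⋀ C_i[a/x_i]` for separator variables `x_i` at the positions `pos`.  As `a` is at the
same position in all atoms `R(…, a, …)` of a predicate, they are written as atoms of a predicate
whose arity is smaller by one (and whose probabilities are given by `PDB.restrict`). -/
def CNF.instantiate [DecidableEq ρ] (Q : CNF ρ) (pos : ρ → ℕ → ℕ) : CNF ρ :=
  Q.image fun C => C.image fun l =>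
    ⟨l.pos, l.rel, l.args.eraseIdx (pos l.rel l.args.length)⟩

/-- The tuples with the constant `a` at the positions `pos`, with that entry left out. -/
def PDB.restrict {n : ℕ} (P : PDB ρ n) (pos : ρ → ℕ → ℕ) (a : Fin n) : PDB ρ n where
  prob R t := P.prob R (t.insertIdx (pos R (t.length + 1)) a)
  nonneg _ _ := P.nonneg _ _
  le_one _ _ := P.le_one _ _

/-! ## The algorithm -/

/-- A way to resolve the choices that the algorithm leaves open.  They depend on the query only, and
so does `work Q`, the time (an arbitrary function of `Q`) that a call with query `Q` spends on them
outside the recursive calls. -/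
structure Implementation (ρ : Type*) [DecidableEq ρ] where
  simplify : CNF ρ → CNF ρ
  simplify_spec : ∀ Q, IsSimplification Q (simplify Q)
  union : CNF ρ → List (CNF ρ)
  union_spec : ∀ Q, IsUnionCNF simplify Q (union Q)
  unionPartition : List (CNF ρ) → List (CNF ρ) × List (CNF ρ)
  unionPartition_spec :
    ∀ U, (∃ p, IsUnionPartition U p) → IsUnionPartition U (unionPartition U)
  terms : List (CNF ρ) → List (CNF ρ)
  terms_spec : ∀ U, IsTermList U (terms U)
  clausePartition : CNF ρ → CNF ρ × CNF ρ
  clausePartition_spec :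
    ∀ Q, (∃ p, IsClausePartition Q p) → IsClausePartition Q (clausePartition Q)
  separator : CNF ρ → (Clause ρ → ℕ) × (ρ → ℕ → ℕ)
  separator_spec : ∀ Q, (∃ sep, IsSeparator Q sep) → IsSeparator Q (separator Q)
  work : CNF ρ → ℕ

/-- The state of a computation: not finished within the given recursion depth, or finished after
`time` steps with the answer FAIL or with a number. -/
inductive Outcome where
  | running : Outcome
  | fail (time : ℕ) : Outcome
  | value (r : ℝ) (time : ℕ) : Outcome

/-- `t` further steps. -/
def Outcome.delay (t : ℕ) : Outcome → Outcome
  | running => running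
  | fail t' => fail (t + t')
  | value r t' => value r (t + t')

/-- Sequential execution. -/
def Outcome.bind (o : Outcome) (f : ℝ → Outcome) : Outcome :=
  match o with
  | running => running
  | fail t => fail t
  | value r t => (f r).delay t

/-- Run all computations and combine their values by a binary operation, one step for each. -/
def Outcome.fold (op : ℝ → ℝ → ℝ) (init : ℝ) : List Outcome → Outcome
  | [] => value init 0
  | o :: os => o.bind fun x => (fold op init os).bind fun y => value (op x y) 1

open Classical in
/-- The algorithm, run on the query `Q₀` and the database `P` with recursion depth at most the first
argument.  Every call, every database look-up and every arithmetic operation takes one step, and a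
call with query `Q₀` takes `S.work Q₀` steps for processing the query. -/
noncomputable def lift [DecidableEq ρ] (S : Implementation ρ) :
    ℕ → CNF ρ → {n : ℕ} → PDB ρ n → Outcome
  | 0, _, _, _ => .running
  | depth + 1, Q₀, n, P =>
    let Q := S.simplify Q₀
    let U := S.union Q
    Outcome.delay (S.work Q₀ + 1) <|
      -- Constants and ground literals.
      if Q = ∅ then .value 1 0
      else if ∅ ∈ Q then .value 0 0
      else if h : ∃ l : Literal ρ, Q = {{l}} ∧ l.args = [] then
        .value (P.literal h.choose) 2
      else if 1 < U.length then
        if ∃ p, IsUnionPartition U p then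
          -- Decomposable disjunction.
          let p := S.unionPartition U
          (lift S depth (disjunction p.1) P).bind fun x =>
            (lift S depth (disjunction p.2) P).bind fun y =>
              .value (1 - (1 - x) * (1 - y)) 4
        else
          -- Inclusion/exclusion, after cancellations.
          Outcome.fold (· + ·) 0 <|
            ((S.terms U).filter fun q => coefficient U q ≠ 0).map fun q =>
              (lift S depth q P).bind fun x => .value (coefficient U q * x) 1
      else if ∃ p, IsClausePartition Q p then
        -- Decomposable conjunction.
        let p := S.clausePartition Q
        (lift S depth p.1 P).bind fun x =>
          (lift S depth p.2 P).bind fun y => .value (x * y) 1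
      else if ∃ sep, IsSeparator Q sep then
        -- Decomposable universal quantifier.
        let pos := (S.separator Q).2
        Outcome.fold (· * ·) 1 <|
          (List.finRange n).map fun a =>
            lift S depth (Q.instantiate pos) (P.restrict pos a)
      else .fail 0

/-- The algorithm halts on `Q` with answer FAIL, whatever the (nonempty) domain and the database. -/
def FailsOn [DecidableEq ρ] (S : Implementation ρ) (Q : CNF ρ) : Prop :=
  ∀ n : ℕ, 1 ≤ n → ∀ P : PDB ρ n, ∃ depth t, lift S depth Q P = .fail t

/-- The algorithm halts on `Q` and `P` after exactly `t` steps and returns `r`. -/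
def Computes [DecidableEq ρ] (S : Implementation ρ) (Q : CNF ρ) {n : ℕ} (P : PDB ρ n) (r : ℝ)
    (t : ℕ) : Prop :=
  ∃ depth, lift S depth Q P = .value r t

/-! ## Implementations exist -/

section Existence

theorem Entails.refl (Q : CNF ρ) : Entails Q Q := fun _ _ _ h => h

theorem Entails.trans {Q Q' Q'' : CNF ρ} (h : Entails Q Q') (h' : Entails Q' Q'') :
    Entails Q Q'' := fun D _ I hQ => h' D I (h D I hQ)

theorem Clause.Holds.mono {D : Type*} {I : World ρ D} {C C' : Clause ρ} (h : C ⊆ C')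
    (hC : C.Holds I) : C'.Holds I := fun v =>
  let ⟨l, hl, hl'⟩ := hC v
  ⟨l, h hl, hl'⟩

theorem Clause.Holds.rename [DecidableEq ρ] {D : Type*} {I : World ρ D} {C : Clause ρ} (σ : ℕ → ℕ)
    (hC : C.Holds I) : (C.rename σ).Holds I := fun v => by
  obtain ⟨l, hl, h⟩ := hC (v ∘ σ)
  refine ⟨l.rename σ, Finset.mem_image_of_mem _ hl, ?_⟩
  simpa [Literal.Holds, Literal.rename] using h

theorem exists_simplification [DecidableEq ρ] (Q : CNF ρ) : ∃ R, IsSimplification Q R := by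
  classical
  let K : Finset (CNF ρ) := (Q.biUnion Finset.powerset).powerset.filter (Equivalent Q)
  have hmem : ∀ R, R ∈ K ↔ (∀ C ∈ R, ∃ C' ∈ Q, C ⊆ C') ∧ Equivalent Q R := by
    intro R
    simp [K, Finset.subset_iff (s₁ := R)]
  have hK : K.Nonempty :=
    ⟨Q, (hmem Q).2 ⟨fun C hC => ⟨C, hC, subset_rfl⟩, Entails.refl Q, Entails.refl Q⟩⟩
  obtain ⟨R, hR, hmin⟩ := K.exists_min_image (fun R => ∑ C ∈ R, (C.card + 1)) hK
  obtain ⟨hsub, h1, h2⟩ := (hmem R).1 hR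
  refine ⟨R, ⟨h1, h2⟩, hsub, fun C hC hred => ?_, fun C hC l hl himp => ?_⟩
  · have hlt : R.erase C ∈ K := by
      refine (hmem _).2 ⟨fun C' hC' => hsub C' (Finset.mem_of_mem_erase hC'), ?_, ?_⟩
      · exact fun D _ I hQ C' hC' => h1 D I hQ C' (Finset.mem_of_mem_erase hC')
      · refine Entails.trans (fun D _ I hI C' hC' => ?_) h2
        by_cases hc : C' = C
        · subst hc
          exact hred D I hI _ (Finset.mem_singleton_self _)
        · exact hI C' (Finset.mem_erase.2 ⟨hc, hC'⟩)
    have := hmin _ hlt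
    have h3 := Finset.add_sum_erase R (fun C => C.card + 1) hC
    omega
  · have hlt : insert (C.erase l) (R.erase C) ∈ K := by
      refine (hmem _).2 ⟨fun C' hC' => ?_, ?_, ?_⟩
      · rcases Finset.mem_insert.1 hC' with rfl | hC'
        · obtain ⟨C', h, h'⟩ := hsub C hC
          exact ⟨C', h, (Finset.erase_subset _ _).trans h'⟩
        · exact hsub C' (Finset.mem_of_mem_erase hC')
      · refine Entails.trans h1 fun D _ I hI C' hC' => ?_
        rcases Finset.mem_insert.1 hC' with rfl | hC'
        · exact himp D I hI _ (Finset.mem_singleton_self _)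
        · exact hI C' (Finset.mem_of_mem_erase hC')
      · refine Entails.trans (fun D _ I hI C' hC' => ?_) h2
        by_cases hc : C' = C
        · subst hc
          exact (hI _ (Finset.mem_insert_self _ _)).mono (Finset.erase_subset _ _)
        · exact hI C' (Finset.mem_insert_of_mem (Finset.mem_erase.2 ⟨hc, hC'⟩))
    have := hmin _ hlt
    have h3 := Finset.add_sum_erase R (fun C => C.card + 1) hC
    have h4 : ∑ C' ∈ insert (C.erase l) (R.erase C), (C'.card + 1) ≤
        ((C.erase l).card + 1) + ∑ C' ∈ R.erase C, (C'.card + 1) := by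
      by_cases hin : C.erase l ∈ R.erase C
      · rw [Finset.insert_eq_of_mem hin]
        omega
      · rw [Finset.sum_insert hin]
    have h5 := Finset.card_erase_lt_of_mem hl
    omega

theorem exists_component (C : Clause ρ) {l : Literal ρ} (hl : l ∈ C) :
    ∃ S, IsComponent C S ∧ l ∈ S := by
  classical
  let K := C.powerset.filter fun S => IsSeparated C S ∧ l ∈ S
  have hK : K.Nonempty := ⟨C, by
    simp only [K, Finset.mem_filter, Finset.mem_powerset]
    exact ⟨subset_rfl, ⟨subset_rfl, ⟨l, hl⟩, fun _ _ l' h h' => absurd h h'⟩, hl⟩⟩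
  obtain ⟨S, hS, hmin⟩ := K.exists_min_image Finset.card hK
  simp only [K, Finset.mem_filter, Finset.mem_powerset] at hS hmin
  obtain ⟨hSC, hsep, hlS⟩ := hS
  refine ⟨S, ⟨hsep, fun T hT hTS => ?_⟩, hlS⟩
  by_cases hlT : l ∈ T
  · exact Finset.eq_of_subset_of_card_le hTS (hmin T ⟨hT.1, hT, hlT⟩)
  · exfalso
    have h1 : IsSeparated C (S \ T) := by
      refine ⟨Finset.sdiff_subset.trans hSC, ⟨l, Finset.mem_sdiff.2 ⟨hlS, hlT⟩⟩, ?_⟩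
      intro a ha b hb hb'
      rw [Finset.mem_sdiff] at ha
      by_cases hbS : b ∈ S
      · have hbT : b ∈ T := by
          by_contra h
          exact hb' (Finset.mem_sdiff.2 ⟨hbS, h⟩)
        exact (hT.2.2 b hbT a (hSC ha.1) ha.2).symm
      · exact hsep.2.2 a ha.1 b hb hbS
    have h2 := hmin _ ⟨h1.1, h1, Finset.mem_sdiff.2 ⟨hlS, hlT⟩⟩
    obtain ⟨t, ht⟩ := hT.2.1
    have h3 : (S \ T).card < S.card := Finset.card_lt_card
      (Finset.ssubset_iff_of_subset Finset.sdiff_subset |>.2 ⟨t, hTS ht, by simp [ht]⟩)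
    omega

theorem IsComponent.eq_of_not_disjoint {C S T : Clause ρ} (hS : IsComponent C S)
    (hT : IsComponent C T) {l l' : Literal ρ} (hl : l ∈ S) (hl' : l' ∈ T)
    (h : ¬ Disjoint l.vars l'.vars) : S = T := by
  classical
  have hlT : l' ∈ S := by
    by_contra hn
    exact h (hS.1.2.2 l hl l' (hT.1.1 hl') hn)
  have hsep : IsSeparated C (S ∩ T) := by
    refine ⟨Finset.inter_subset_left.trans hS.1.1, ⟨l', Finset.mem_inter.2 ⟨hlT, hl'⟩⟩, ?_⟩
    intro a ha b hb hb'
    rw [Finset.mem_inter] at ha hb'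
    by_cases hbS : b ∈ S
    · exact hT.1.2.2 a ha.2 b hb fun hbT => hb' ⟨hbS, hbT⟩
    · exact hS.1.2.2 a ha.1 b hb hbS
  rw [← hS.2 _ hsep Finset.inter_subset_left, ← hT.2 _ hsep Finset.inter_subset_right]
  simp

theorem mem_components {C S : Clause ρ} : S ∈ components C ↔ IsComponent C S := by
  simp only [components, Finset.mem_filter, Finset.mem_powerset, and_iff_right_iff_imp]
  exact fun h => h.1.1

/-- A clause is the disjunction of its connected components. -/
theorem holds_iff_exists_component {D : Type*} [Nonempty D] (I : World ρ D) (C : Clause ρ) :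
    C.Holds I ↔ ∃ S ∈ components C, Clause.Holds I S := by
  classical
  constructor
  · intro hC
    by_contra hno
    push Not at hno
    have hv : ∀ S : Clause ρ, ∃ v : ℕ → D, S ∈ components C → ∀ l ∈ S, ¬ l.Holds I v := by
      intro S
      by_cases hS : S ∈ components C
      · have := hno S hS
        simp only [Clause.Holds, not_forall, not_exists, not_and] at this
        obtain ⟨v, hv⟩ := this
        exact ⟨v, fun _ => hv⟩
      · exact ⟨fun _ => Classical.arbitrary D, fun h => absurd h hS⟩
    choose v hv using hv
    let w : ℕ → D := fun x =>
      if h : ∃ S ∈ components C, x ∈ Clause.vars S then v h.choose x else Classical.arbitrary D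
    obtain ⟨l, hl, hlw⟩ := hC w
    obtain ⟨S, hS, hlS⟩ := exists_component C hl
    have hS' := mem_components.2 hS
    refine hv S hS' l hlS ?_
    have hargs : l.args.map w = l.args.map (v S) := by
      refine List.map_congr_left fun x hx => ?_
      have hxl : x ∈ l.vars := List.mem_toFinset.2 hx
      have hex : ∃ S ∈ components C, x ∈ Clause.vars S :=
        ⟨S, hS', Finset.mem_biUnion.2 ⟨l, hlS, hxl⟩⟩
      have heq : hex.choose = S := by
        obtain ⟨h1, h2⟩ := hex.choose_spec
        obtain ⟨l', hl', hx'⟩ := Finset.mem_biUnion.1 h2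
        exact (mem_components.1 h1).eq_of_not_disjoint hS hl' hlS
          (Finset.not_disjoint_iff.2 ⟨x, hx', hxl⟩)
      simp only [w, dif_pos hex, heq]
    simpa only [Literal.Holds, hargs] using hlw
  · rintro ⟨S, hS, hSI⟩
    exact hSI.mono (mem_components.1 hS).1.1

/-- Up to equivalence, there are finitely many clauses of bounded size over given predicates. -/
theorem exists_small_clauses [DecidableEq ρ] (Sy : Finset (ρ × ℕ)) (M : ℕ) :
    ∃ B : Finset (Clause ρ), ∀ C : Clause ρ, C.card ≤ M → (∀ l ∈ C, l.symbol ∈ Sy) →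
      ∃ C' ∈ B, Equivalent {C} {C'} := by
  classical
  let k := Sy.sup Prod.snd
  let N := M * k
  let L : Finset (Literal ρ) := Sy.biUnion fun s =>
    (Finset.univ : Finset (Bool × (Fin s.2 → Fin N))).image fun t =>
      ⟨t.1, s.1, List.ofFn fun i => (t.2 i : ℕ)⟩
  refine ⟨L.powerset, fun C hM hC => ?_⟩
  have hN : C.vars.card ≤ N := by
    refine (Finset.card_biUnion_le_card_mul _ _ k fun l hl => ?_).trans
      (Nat.mul_le_mul_right _ hM)
    exact (List.toFinset_card_le _).trans (Finset.le_sup (f := Prod.snd) (hC l hl))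
  let e := C.vars.equivFin
  let σ : ℕ → ℕ := fun x => if h : x ∈ C.vars then (e ⟨x, h⟩ : ℕ) else 0
  let τ : ℕ → ℕ := fun i => if h : i < C.vars.card then (e.symm ⟨i, h⟩ : ℕ) else 0
  have hτ : ∀ x ∈ C.vars, τ (σ x) = x := by
    intro x hx
    simp [σ, τ, hx]
  have hback : Clause.rename τ (Clause.rename σ C) = C := by
    have : ∀ l ∈ C, (l.rename σ).rename τ = l := by
      intro l hl
      have h : (l.args.map σ).map τ = l.args := by
        rw [List.map_map]
        conv_rhs => rw [← List.map_id l.args]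
        refine List.map_congr_left fun x hx => ?_
        exact hτ x (Finset.mem_biUnion.2 ⟨l, hl, List.mem_toFinset.2 hx⟩)
      simp only [Literal.rename, h]
    rw [Clause.rename, Clause.rename, Finset.image_image]
    ext l
    simp only [Finset.mem_image, Function.comp_apply]
    constructor
    · rintro ⟨l', hl', rfl⟩
      rwa [this l' hl']
    · exact fun hl => ⟨l, hl, this l hl⟩
  refine ⟨Clause.rename σ C, ?_, ?_, ?_⟩
  · rw [Finset.mem_powerset]
    intro l' hl'
    obtain ⟨l, hl, rfl⟩ := Finset.mem_image.1 hl'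
    have hlt : ∀ i : Fin l.args.length, σ (l.args.get i) < N := by
      intro i
      have hx : l.args.get i ∈ C.vars :=
        Finset.mem_biUnion.2 ⟨l, hl, List.mem_toFinset.2 (List.get_mem _ _)⟩
      simp only [σ, dif_pos hx]
      exact (Fin.is_lt _).trans_le hN
    refine Finset.mem_biUnion.2 ⟨l.symbol, hC l hl, Finset.mem_image.2
      ⟨(l.pos, fun i => ⟨σ (l.args.get i), hlt i⟩), Finset.mem_univ _, ?_⟩⟩
    have : List.ofFn (fun i : Fin l.args.length => σ (l.args.get i)) = l.args.map σ := by
      apply List.ext_getElem <;> simp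
    simp only [Literal.rename, Literal.symbol, ← this]
  · intro D _ I hI C' hC'
    obtain rfl := Finset.mem_singleton.1 hC'
    exact (hI C (Finset.mem_singleton_self _)).rename σ
  · intro D _ I hI C' hC'
    obtain rfl := Finset.mem_singleton.1 hC'
    have := (hI _ (Finset.mem_singleton_self _)).rename τ
    rwa [hback] at this

theorem exists_splittings [DecidableEq ρ] (Q : CNF ρ) :
    ∃ 𝒞 : Finset (Clause ρ), (∀ C ∈ 𝒞, IsSplitting Q C) ∧
      ∀ C, IsSplitting Q C → ∃ C' ∈ 𝒞, Equivalent {C} {C'} := by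
  classical
  obtain ⟨B, hB⟩ := exists_small_clauses Q.symbols (Q.sup Finset.card)
  let φ : Clause ρ → Finset (Clause ρ) := fun C =>
    B.filter fun b => ∃ D ∈ components C, Equivalent {D} {b}
  let A : Set (Clause ρ) := {C | IsSplitting Q C}
  have hfin : (φ '' A).Finite := (B.powerset.finite_toSet).subset (by
    rintro _ ⟨C, -, rfl⟩
    exact Finset.mem_coe.2 (Finset.mem_powerset.2 (Finset.filter_subset _ _)))
  obtain ⟨𝒞, h𝒞, him⟩ := Finset.subset_set_image_iff.1
    (show (hfin.toFinset : Set (Finset (Clause ρ))) ⊆ φ '' A by simp)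
  have key : ∀ C C', IsSplitting Q C → φ C = φ C' → Entails {C} {C'} := by
    intro C C' hC hφ D _ I hI E hE
    obtain rfl := Finset.mem_singleton.1 hE
    obtain ⟨S, hS, hSI⟩ := (holds_iff_exists_component I C).1 (hI C (Finset.mem_singleton_self _))
    obtain ⟨F, hF, ⟨σ, hσ⟩, hcard⟩ := hC.2.2.2 S hS
    obtain ⟨b, hb, hSb⟩ := hB S (hcard.trans (Finset.le_sup (f := Finset.card) hF)) (by
      intro l hl
      refine Finset.mem_biUnion.2 ⟨F, hF, Finset.mem_image.2
        ⟨l.rename σ, hσ (Finset.mem_image_of_mem _ hl), ?_⟩⟩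
      simp [Literal.symbol, Literal.rename])
    have hbφ : b ∈ φ C := Finset.mem_filter.2 ⟨hb, S, hS, hSb⟩
    rw [hφ] at hbφ
    obtain ⟨-, S', hS', hSb'⟩ := Finset.mem_filter.1 hbφ
    refine (holds_iff_exists_component I _).2 ⟨S', hS', ?_⟩
    refine hSb'.2 D I (hSb.1 D I ?_) _ (Finset.mem_singleton_self _)
    intro C'' h
    obtain rfl := Finset.mem_singleton.1 h
    exact hSI
  refine ⟨𝒞, fun C hC => h𝒞 hC, fun C hC => ?_⟩
  have : φ C ∈ 𝒞.image φ := by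
    rw [him]
    simpa using ⟨C, hC, rfl⟩
  obtain ⟨C', hC', hφ⟩ := Finset.mem_image.1 this
  exact ⟨C', hC', key C C' hC hφ.symm, key C' C (h𝒞 hC') hφ⟩

theorem exists_maximal_list (L : List (CNF ρ)) :
    ∃ U : List (CNF ρ), (∀ q ∈ U, q ∈ L) ∧ (∀ d ∈ L, ∃ q ∈ U, Entails d q) ∧
      U.Pairwise fun q q' => ¬ Entails q q' ∧ ¬ Entails q' q := by
  classical
  induction L with
  | nil => exact ⟨[], by simp, by simp, by simp⟩
  | cons a L ih =>
    obtain ⟨U, h1, h2, h3⟩ := ih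
    by_cases h : ∃ u ∈ U, Entails a u
    · exact ⟨U, fun q hq => List.mem_cons_of_mem _ (h1 q hq), by simpa using ⟨h, h2⟩, h3⟩
    · push Not at h
      refine ⟨a :: U.filter fun u => ¬ Entails u a, ?_, ?_, ?_⟩
      · intro q hq
        rcases List.mem_cons.1 hq with rfl | hq
        · exact List.mem_cons_self
        · exact List.mem_cons_of_mem _ (h1 q (List.mem_of_mem_filter hq))
      · intro d hd
        rcases List.mem_cons.1 hd with rfl | hd
        · exact ⟨d, List.mem_cons_self, Entails.refl _⟩
        · obtain ⟨q, hq, hdq⟩ := h2 d hd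
          by_cases hqa : Entails q a
          · exact ⟨a, List.mem_cons_self, hdq.trans hqa⟩
          · exact ⟨q, List.mem_cons_of_mem _ (List.mem_filter.2 ⟨hq, by simpa using hqa⟩), hdq⟩
      · refine List.pairwise_cons.2 ⟨fun q hq => ?_, h3.filter _⟩
        obtain ⟨hq, hqa⟩ := List.mem_filter.1 hq
        exact ⟨h q hq, by simpa using hqa⟩

theorem exists_termList [DecidableEq ρ] (U : List (CNF ρ)) : ∃ T, IsTermList U T := by
  classical
  have key : ∀ L : List (CNF ρ), ∃ T : List (CNF ρ), (∀ q ∈ T, q ∈ L) ∧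
      (∀ d ∈ L, ∃ q ∈ T, Equivalent d q) ∧ T.Pairwise fun q q' => ¬ Equivalent q q' := by
    intro L
    induction L with
    | nil => exact ⟨[], by simp, by simp, by simp⟩
    | cons a L ih =>
      obtain ⟨T, h1, h2, h3⟩ := ih
      by_cases h : ∃ u ∈ T, Equivalent a u
      · exact ⟨T, fun q hq => List.mem_cons_of_mem _ (h1 q hq), by simpa using ⟨h, h2⟩, h3⟩
      · push Not at h
        refine ⟨a :: T, ?_, ?_, List.pairwise_cons.2 ⟨h, h3⟩⟩
        · intro q hq
          rcases List.mem_cons.1 hq with rfl | hq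
          · exact List.mem_cons_self
          · exact List.mem_cons_of_mem _ (h1 q hq)
        · intro d hd
          rcases List.mem_cons.1 hd with rfl | hd
          · exact ⟨d, List.mem_cons_self, Entails.refl _, Entails.refl _⟩
          · obtain ⟨q, hq, hdq⟩ := h2 d hd
            exact ⟨q, List.mem_cons_of_mem _ hq, hdq⟩
  obtain ⟨T, h1, h2, h3⟩ := key
    (((Finset.univ : Finset (Finset (Fin U.length))).filter Finset.Nonempty).toList.map
      (conjunction U))
  refine ⟨T, fun q hq => ?_, fun s hs => h2 _ ?_, h3⟩
  · obtain ⟨s, hs, rfl⟩ := List.mem_map.1 (h1 q hq)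
    exact ⟨s, by simpa using hs, rfl⟩
  · exact List.mem_map.2 ⟨s, by simpa using hs, rfl⟩

/-- All the choices of the algorithm can be made. -/
theorem Implementation.nonempty [DecidableEq ρ] : Nonempty (Implementation ρ) := by
  classical
  choose simplify hs using exists_simplification (ρ := ρ)
  have hU : ∀ Q : CNF ρ, ∃ U, IsUnionCNF simplify Q U := by
    intro Q
    obtain ⟨𝒞, h1, h2⟩ := exists_splittings Q
    obtain ⟨U, h3, h4, h5⟩ := exists_maximal_list ((distribute 𝒞 Q).toList.map simplify)
    refine ⟨U, 𝒞, h1, h2, fun q hq => ?_, fun d hd => ?_, h5⟩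
    · obtain ⟨d, hd, rfl⟩ := List.mem_map.1 (h3 q hq)
      exact ⟨d, by simpa using hd, rfl⟩
    · obtain ⟨q, hq, hdq⟩ := h4 (simplify d) (List.mem_map.2 ⟨d, by simpa using hd, rfl⟩)
      exact ⟨q, hq, (hs d).1.1.trans hdq⟩
  choose union hunion using hU
  choose terms hterms using exists_termList (ρ := ρ)
  have pick : ∀ {α : Type _} [Nonempty α] (p : α → Prop), ∃ a, (∃ x, p x) → p a := by
    intro α _ p
    by_cases h : ∃ x, p x
    · exact ⟨h.choose, fun _ => h.choose_spec⟩
    · exact ⟨Classical.arbitrary α, fun h' => absurd h' h⟩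
  choose up hup using fun U : List (CNF ρ) => pick (IsUnionPartition U)
  choose cp hcp using fun Q : CNF ρ => pick (IsClausePartition Q)
  have hsep : ∀ Q : CNF ρ, ∃ a, (∃ x, IsSeparator Q x) → IsSeparator Q a := by
    intro Q
    by_cases h : ∃ x, IsSeparator Q x
    · exact ⟨h.choose, fun _ => h.choose_spec⟩
    · exact ⟨(fun _ => 0, fun _ _ => 0), fun h' => absurd h' h⟩
  choose sp hsp using hsep
  exact ⟨⟨simplify, hs, union, hunion, up, hup, terms, hterms, cp, hcp, sp, hsp, fun _ => 0⟩⟩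

end Existence

end LiftR

/-!
The world of true ground atoms is a random subset in which distinct atoms are independent, so each
rule of the algorithm is an identity between the probabilities of events: predicates without common
symbols give independent events, inclusion/exclusion applies to a union, and the instances of a
query at the different values of its separator variables depend on disjoint sets of ground atoms,
because atoms agree on the position of the separator and none repeats a variable.

The recursion depth is bounded by a function of the query alone. Every call either has fewer
predicates or smaller arities, or it is a strict strengthening, by clauses over the same predicates
that are not longer than those of the query. As there are finitely many such clauses up to
equivalence, a chain of strengthenings is bounded. Hence it is independent of the database whether
some call fails. Only the separator rule makes a number of calls that depends on the domain, namely
`n`, and it lowers the maximal arity, which gives the time bound.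
-/

namespace LiftR

variable {ρ : Type*}

/-! ## Random subsets of a finite set -/

section RandomSubset

open Finset

variable {R ι α β : Type*} [CommRing R] [DecidableEq α] {p : α → R} {A B : Finset α}
  {E F : Set (Finset α)}

/-- The weight of the subset `I` of `A` if each `g ∈ A` is selected independently, with
probability `p g`. -/
def weight (p : α → R) (A I : Finset α) : R := ∏ g ∈ A, if g ∈ I then p g else 1 - p g

/-- The probability of the event `E` for the random subset of `A` with weights `weight p A`. -/
noncomputable def eventProb (p : α → R) (A : Finset α) (E : Set (Finset α)) : R :=
  ∑ I ∈ A.powerset, E.indicator (weight p A) I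

/-- The event `E` only depends on which elements of `A` are selected. -/
def DeterminedBy (A : Finset α) (E : Set (Finset α)) : Prop := ∀ I, I ∩ A ∈ E ↔ I ∈ E

theorem eventProb_congr (h : ∀ I ⊆ A, (I ∈ E ↔ I ∈ F)) : eventProb p A E = eventProb p A F := by
  refine sum_congr rfl fun I hI => ?_
  classical
  simp only [Set.indicator_apply, h I (mem_powerset.1 hI)]

theorem weight_eq_prod_mul_prod {I : Finset α} (hI : I ⊆ A) :
    weight p A I = (∏ g ∈ I, p g) * ∏ g ∈ A \ I, (1 - p g) := by
  rw [weight, prod_ite, filter_mem_eq_inter, inter_eq_right.2 hI, filter_notMem_eq_sdiff]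

theorem eventProb_univ : eventProb p A Set.univ = 1 := by
  calc eventProb p A Set.univ = ∑ I ∈ A.powerset, (∏ g ∈ I, p g) * ∏ g ∈ A \ I, (1 - p g) :=
        sum_congr rfl fun I hI => by
          rw [Set.indicator_univ, weight_eq_prod_mul_prod (mem_powerset.1 hI)]
    _ = ∏ g ∈ A, (p g + (1 - p g)) := (prod_add _ _ A).symm
    _ = 1 := by simp only [add_sub_cancel, prod_const_one]

theorem eventProb_empty : eventProb p A ∅ = 0 := by
  simp only [eventProb, Set.indicator_empty, sum_const_zero]

theorem eventProb_compl (p : α → R) (A : Finset α) (E : Set (Finset α)) :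
    eventProb p A Eᶜ = 1 - eventProb p A E := by
  rw [eq_sub_iff_add_eq', ← eventProb_univ (p := p) (A := A)]
  simp only [eventProb, ← sum_add_distrib, Set.indicator_self_add_compl_apply, Set.indicator_univ]

theorem eventProb_biUnion (p : α → R) (A : Finset α) (s : Finset ι) (E : ι → Set (Finset α)) :
    eventProb p A (⋃ i ∈ s, E i) =
      ∑ t ∈ s.powerset with t.Nonempty, (-1) ^ (#t + 1) * eventProb p A (⋂ i ∈ t, E i) := by
  simp only [eventProb, indicator_biUnion_eq_sum_powerset, mul_sum]
  rw [sum_comm]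
  simp only [zsmul_eq_mul, Int.cast_pow, Int.cast_neg, Int.cast_one]

theorem eventProb_image [DecidableEq β] (q : β → R) {f : α → β} (hf : Set.InjOn f A)
    (E : Set (Finset β)) :
    eventProb q (A.image f) E = eventProb (q ∘ f) A {I | I.image f ∈ E} := by
  have mem_image_iff {I : Finset α} (hI : I ∈ A.powerset) {g : α} (hg : g ∈ A) :
      f g ∈ I.image f ↔ g ∈ I := by
    simpa using hf.mem_image_iff (coe_subset.2 (mem_powerset.1 hI)) hg
  rw [eventProb, powerset_image, sum_image]
  · refine sum_congr rfl fun I hI => ?_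
    have hweight : weight q (A.image f) (I.image f) = weight (q ∘ f) A I := by
      rw [weight, prod_image hf]
      exact prod_congr rfl fun g hg => by simp only [mem_image_iff hI hg, Function.comp_apply]
    classical
    simp only [Set.indicator_apply, Set.mem_ofPred_eq, hweight]
  · exact image_injOn_powerset_of_injOn hf

theorem DeterminedBy.mono (hE : DeterminedBy A E) (h : A ⊆ B) : DeterminedBy B E := fun I => by
  rw [← hE (I ∩ B), inter_assoc, inter_eq_right.2 h, hE]

theorem DeterminedBy.compl (hE : DeterminedBy A E) : DeterminedBy A Eᶜ := fun I =>
  (hE I).not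

theorem DeterminedBy.inter (hE : DeterminedBy A E) (hF : DeterminedBy B F) :
    DeterminedBy (A ∪ B) (E ∩ F) := fun I =>
  and_congr (hE.mono subset_union_left I) (hF.mono subset_union_right I)

theorem DeterminedBy.biInter {s : Finset ι} {A : ι → Finset α} {E : ι → Set (Finset α)}
    (hE : ∀ i ∈ s, DeterminedBy (A i) (E i)) : DeterminedBy (s.biUnion A) (⋂ i ∈ s, E i) :=
  fun I => by
    simp only [Set.mem_iInter]
    exact forall₂_congr fun i hi => (hE i hi).mono (subset_biUnion_of_mem A hi) I

theorem weight_union (hAB : Disjoint A B) (I : Finset α) :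
    weight p (A ∪ B) I = weight p A (I ∩ A) * weight p B (I ∩ B) := by
  rw [weight, prod_union hAB]
  congr 1 <;> refine prod_congr rfl fun g hg => ?_ <;> simp only [mem_inter, hg, and_true]

theorem eventProb_inter (hAB : Disjoint A B) (hE : DeterminedBy A E) (hF : DeterminedBy B F) :
    eventProb p (A ∪ B) (E ∩ F) = eventProb p A E * eventProb p B F := by
  rw [eventProb, eventProb, eventProb, sum_mul_sum, ← sum_product']
  refine sum_nbij' (fun I => (I ∩ A, I ∩ B)) (fun x => x.1 ∪ x.2) ?_ ?_ ?_ ?_ ?_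
  · simp only [mem_product, mem_powerset, inter_subset_right, and_self, implies_true]
  · simp only [mem_product, mem_powerset]
    exact fun x hx => union_subset_union hx.1 hx.2
  · intro I hI
    rw [← inter_union_distrib_left, inter_eq_left.2 (mem_powerset.1 hI)]
  · rintro ⟨I, J⟩ h
    obtain ⟨hI, hJ⟩ : I ⊆ A ∧ J ⊆ B := by simpa only [mem_product, mem_powerset] using h
    simp only [union_inter_distrib_right, inter_eq_left.2 hI, inter_eq_left.2 hJ,
      disjoint_iff_inter_eq_empty.1 (hAB.mono_left hI),
      disjoint_iff_inter_eq_empty.1 (hAB.symm.mono_left hJ), union_empty, empty_union]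
  · intro I _
    classical
    simp only [Set.indicator_apply, Set.mem_inter_iff, hE I, hF I, weight_union hAB,
      ite_zero_mul_ite_zero]

theorem eventProb_of_subset (h : A ⊆ B) (hE : DeterminedBy A E) :
    eventProb p B E = eventProb p A E := by
  have huniv : DeterminedBy (B \ A) Set.univ := fun _ => Iff.rfl
  simpa only [union_sdiff_of_subset h, Set.inter_univ, eventProb_univ, mul_one]
    using eventProb_inter (p := p) disjoint_sdiff hE huniv

theorem eventProb_biInter {s : Finset ι} {A : ι → Finset α} {E : ι → Set (Finset α)}
    (hA : (s : Set ι).PairwiseDisjoint A) (hE : ∀ i ∈ s, DeterminedBy (A i) (E i)) :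
    eventProb p (s.biUnion A) (⋂ i ∈ s, E i) = ∏ i ∈ s, eventProb p (A i) (E i) := by
  classical
  induction s using Finset.induction_on with
  | empty => simpa using eventProb_univ
  | insert i s hi ih =>
    rw [coe_insert, Set.pairwiseDisjoint_insert_of_notMem hi] at hA
    rw [forall_mem_insert] at hE
    rw [biUnion_insert, set_biInter_insert, prod_insert hi, ← ih hA.1 hE.2]
    exact eventProb_inter ((disjoint_biUnion_right _ _ _).2 hA.2) hE.1 (.biInter hE.2)

theorem eventProb_mem {g : α} (hg : g ∈ A) : eventProb p A {I | g ∈ I} = p g := by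
  have hdet : DeterminedBy {g} {I : Finset α | g ∈ I} := fun I => by simp
  rw [eventProb_of_subset (singleton_subset_iff.2 hg) hdet, eventProb, ← insert_empty_eq,
    sum_powerset_insert (notMem_empty g)]
  simp [weight]

end RandomSubset

/-! ## Semantics of queries -/

section Semantics

variable {D : Type*} {I J : World ρ D} {Q Q' : CNF ρ}

theorem Clause.holds_congr {C : Clause ρ}
    (h : ∀ l ∈ C, ∀ v : ℕ → D, I l.rel (l.args.map v) ↔ J l.rel (l.args.map v)) :
    C.Holds I ↔ C.Holds J := by
  refine forall_congr' fun v => exists_congr fun l => and_congr_right fun hl => ?_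
  simp only [Literal.Holds, h l hl v]

theorem CNF.holds_congr
    (h : ∀ C ∈ Q, ∀ l ∈ C, ∀ v : ℕ → D, I l.rel (l.args.map v) ↔ J l.rel (l.args.map v)) :
    Q.Holds I ↔ Q.Holds J :=
  forall₂_congr fun C hC => Clause.holds_congr (h C hC)

theorem CNF.holds_empty : (∅ : CNF ρ).Holds I := fun _ hC => absurd hC (Finset.notMem_empty _)

theorem CNF.holds_singleton {C : Clause ρ} : CNF.Holds I {C} ↔ C.Holds I := by
  simp only [CNF.Holds, Finset.mem_singleton, forall_eq]

theorem CNF.not_holds_of_empty_mem [Nonempty D] (h : ∅ ∈ Q) : ¬ Q.Holds I := fun hQ =>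
  let ⟨_, hl, _⟩ := hQ ∅ h fun _ => Classical.arbitrary D
  Finset.notMem_empty _ hl

theorem Equivalent.symm (h : Equivalent Q Q') : Equivalent Q' Q := ⟨h.2, h.1⟩

theorem Equivalent.trans {Q'' : CNF ρ} (h : Equivalent Q Q') (h' : Equivalent Q' Q'') :
    Equivalent Q Q'' :=
  ⟨Entails.trans h.1 h'.1, Entails.trans h'.2 h.2⟩

theorem Equivalent.holds_iff {D : Type} [Nonempty D] {I : World ρ D} (h : Equivalent Q Q') :
    Q.Holds I ↔ Q'.Holds I :=
  ⟨h.1 D I, h.2 D I⟩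

variable [DecidableEq ρ]

theorem CNF.holds_union : (Q ∪ Q').Holds I ↔ Q.Holds I ∧ Q'.Holds I :=
  Finset.forall_mem_union

theorem Clause.holds_union_shift (C E : Clause ρ) :
    Clause.Holds I (C ∪ E.rename (· + (C.vars.sup id + 1))) ↔ C.Holds I ∨ E.Holds I := by
  refine ⟨fun h => ?_, ?_⟩
  · by_contra! hno
    simp only [Clause.Holds, not_forall, not_exists, not_and] at hno
    obtain ⟨⟨v, hv⟩, w, hw⟩ := hno
    obtain ⟨l, hl, hl'⟩ := h fun x =>
      if x ≤ C.vars.sup id then v x else w (x - (C.vars.sup id + 1))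
    rcases Finset.mem_union.1 hl with hl | hl
    · refine hv l hl ?_
      rwa [Literal.Holds, List.map_congr_left (g := v)] at hl'
      intro x hx
      have hle : x ≤ C.vars.sup id := Finset.le_sup (f := id)
        (Finset.mem_biUnion.2 ⟨l, hl, List.mem_toFinset.2 hx⟩)
      simp only [hle, if_true]
    · obtain ⟨l, hlE, rfl⟩ := Finset.mem_image.1 hl
      refine hw l hlE ?_
      simp only [Literal.Holds, Literal.rename, List.map_map] at hl'
      rwa [List.map_congr_left (g := w)] at hl'
      intro x _
      have hlt : ¬ x + (C.vars.sup id + 1) ≤ C.vars.sup id := by omega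
      simp only [Function.comp_apply, hlt, if_false, Nat.add_sub_cancel]
  · rintro (h | h)
    · exact h.mono Finset.subset_union_left
    · exact (h.rename _).mono Finset.subset_union_right

theorem CNF.holds_or : (Q.or Q').Holds I ↔ Q.Holds I ∨ Q'.Holds I := by
  simp only [CNF.Holds, CNF.or, Finset.forall_mem_image₂, Clause.holds_union_shift]
  constructor
  · intro h
    by_contra! hno
    obtain ⟨⟨C, hC, hC'⟩, E, hE, hE'⟩ := hno
    exact (h C hC E hE).elim hC' hE'
  · exact fun h C hC E hE => h.imp (· C hC) (· E hE)

theorem holds_disjunction [Nonempty D] {U : List (CNF ρ)} :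
    (disjunction U).Holds I ↔ ∃ q ∈ U, q.Holds I := by
  induction U with
  | nil =>
    simp only [List.not_mem_nil, false_and, exists_false, iff_false]
    exact CNF.not_holds_of_empty_mem (Finset.mem_singleton_self _)
  | cons q U ih =>
    rw [show disjunction (q :: U) = q.or (disjunction U) from rfl, CNF.holds_or, ih]
    simp only [List.mem_cons, exists_eq_or_imp]

theorem holds_conjunction {U : List (CNF ρ)} {s : Finset (Fin U.length)} :
    (conjunction U s).Holds I ↔ ∀ i ∈ s, (U.get i).Holds I := by
  simp only [CNF.Holds, conjunction, Finset.mem_biUnion]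
  exact ⟨fun h i hi C hC => h C ⟨i, hi, hC⟩, fun h C ⟨i, hi, hC⟩ => h i hi C hC⟩

theorem CNF.mem_symbols {s : ρ × ℕ} : s ∈ Q.symbols ↔ ∃ C ∈ Q, ∃ l ∈ C, l.symbol = s := by
  simp only [CNF.symbols, Finset.mem_biUnion, Finset.mem_image]

theorem CNF.symbol_mem_symbols {C : Clause ρ} {l : Literal ρ} (hC : C ∈ Q) (hl : l ∈ C) :
    l.symbol ∈ Q.symbols := CNF.mem_symbols.2 ⟨C, hC, l, hl, rfl⟩

theorem CNF.symbols_union (Q Q' : CNF ρ) : (Q ∪ Q').symbols = Q.symbols ∪ Q'.symbols :=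
  Finset.union_biUnion

end Semantics

/-! ## Probabilities of queries -/

section Probability

variable {n : ℕ}

/-- The probability that the ground atom `g` is true. -/
def PDB.atom (P : PDB ρ n) (g : ρ × List (Fin n)) : ℝ := P.prob g.1 g.2

/-- The event that `Q` is true, as a family of sets of true ground atoms. -/
def models (n : ℕ) (Q : CNF ρ) : Set (Finset (ρ × List (Fin n))) :=
  {I | Q.Holds fun R t => (R, t) ∈ I}

theorem mem_models {Q : CNF ρ} {I : Finset (ρ × List (Fin n))} :
    I ∈ models n Q ↔ Q.Holds fun R t => (R, t) ∈ I := Iff.rfl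

theorem models_congr (hn : 1 ≤ n) {Q Q' : CNF ρ} (h : Equivalent Q Q') :
    models n Q = models n Q' :=
  have : Nonempty (Fin n) := ⟨⟨0, hn⟩⟩
  Set.ext fun _ => h.holds_iff

variable [DecidableEq ρ]

theorem mem_groundAtoms {Q : CNF ρ} {g : ρ × List (Fin n)} :
    g ∈ groundAtoms n Q ↔ (g.1, g.2.length) ∈ Q.symbols := by
  obtain ⟨R, t⟩ := g
  simp only [groundAtoms, Finset.mem_biUnion, Finset.mem_image, Finset.mem_univ, true_and,
    Prod.mk.injEq]
  constructor
  · rintro ⟨⟨R', k⟩, h, f, rfl, rfl⟩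
    rwa [List.length_ofFn]
  · exact fun h => ⟨(R, t.length), h, t.get, rfl, List.ofFn_get t⟩

theorem groundAtoms_union (Q Q' : CNF ρ) :
    groundAtoms n (Q ∪ Q') = groundAtoms n Q ∪ groundAtoms n Q' := by
  ext g
  simp only [Finset.mem_union, mem_groundAtoms, CNF.symbols_union]

theorem groundAtoms_disjoint {Q Q' : CNF ρ} (h : Disjoint Q.symbols Q'.symbols) :
    Disjoint (groundAtoms n Q) (groundAtoms n Q') :=
  Finset.disjoint_left.2 fun _ hg hg' =>
    Finset.disjoint_left.1 h (mem_groundAtoms.1 hg) (mem_groundAtoms.1 hg')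

theorem holds_congr_groundAtoms {Q : CNF ρ} {I J : World ρ (Fin n)}
    (h : ∀ g ∈ groundAtoms n Q, I g.1 g.2 ↔ J g.1 g.2) : Q.Holds I ↔ Q.Holds J :=
  CNF.holds_congr fun C hC l hl v => h (l.rel, l.args.map v) <| mem_groundAtoms.2 <| by
    simpa only [List.length_map, Literal.symbol] using CNF.symbol_mem_symbols hC hl

theorem determinedBy_models (Q : CNF ρ) : DeterminedBy (groundAtoms n Q) (models n Q) :=
  fun _ => holds_congr_groundAtoms fun _ hg => by simp only [Finset.mem_inter, hg, and_true]

theorem Pr_eq_eventProb (P : PDB ρ n) (Q : CNF ρ) :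
    Pr P Q = eventProb P.atom (groundAtoms n Q) (models n Q) := by
  classical
  refine Finset.sum_congr rfl fun I _ => ?_
  simp only [Set.indicator_apply, mem_models, weight, PDB.atom]

theorem Pr_eq_eventProb_of_subset (P : PDB ρ n) {Q : CNF ρ} {A : Finset (ρ × List (Fin n))}
    (hA : groundAtoms n Q ⊆ A) : Pr P Q = eventProb P.atom A (models n Q) := by
  rw [Pr_eq_eventProb, eventProb_of_subset hA (determinedBy_models Q)]

theorem Pr_congr (hn : 1 ≤ n) (P : PDB ρ n) {Q Q' : CNF ρ} (h : Equivalent Q Q') :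
    Pr P Q = Pr P Q' := by
  rw [Pr_eq_eventProb_of_subset P (Finset.subset_union_left (s₂ := groundAtoms n Q')),
    Pr_eq_eventProb_of_subset P (Finset.subset_union_right (s₁ := groundAtoms n Q)),
    models_congr hn h]

theorem Pr_empty (P : PDB ρ n) : Pr P (∅ : CNF ρ) = 1 := by
  have hmodels : models n (∅ : CNF ρ) = Set.univ := Set.eq_univ_of_forall fun _ => CNF.holds_empty
  rw [Pr_eq_eventProb, hmodels, eventProb_univ]

theorem Pr_of_empty_mem (hn : 1 ≤ n) (P : PDB ρ n) {Q : CNF ρ} (h : ∅ ∈ Q) : Pr P Q = 0 := by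
  have : Nonempty (Fin n) := ⟨⟨0, hn⟩⟩
  have hmodels : models n Q = ∅ :=
    Set.eq_empty_of_forall_notMem fun _ => CNF.not_holds_of_empty_mem h
  rw [Pr_eq_eventProb, hmodels, eventProb_empty]

theorem Pr_literal (hn : 1 ≤ n) (P : PDB ρ n) {l : Literal ρ} (hl : l.args = []) :
    Pr P {{l}} = P.literal l := by
  obtain ⟨pos, R, args⟩ := l
  obtain rfl : args = [] := hl
  have hmem : (R, []) ∈ groundAtoms n ({{⟨pos, R, []⟩}} : CNF ρ) :=
    mem_groundAtoms.2 (CNF.symbol_mem_symbols (Finset.mem_singleton_self _)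
      (Finset.mem_singleton_self _))
  have hprob : eventProb P.atom (groundAtoms n ({{⟨pos, R, []⟩}} : CNF ρ)) {I | (R, []) ∈ I} =
      P.prob R [] := eventProb_mem hmem
  have hmodels : models n ({{⟨pos, R, []⟩}} : CNF ρ) =
      if pos then {I | (R, []) ∈ I} else {I | (R, []) ∈ I}ᶜ := by
    have : Nonempty (ℕ → Fin n) := ⟨fun _ => ⟨0, hn⟩⟩
    ext I
    cases pos <;> simp [mem_models, CNF.holds_singleton, Clause.Holds, Literal.Holds]
  rw [Pr_eq_eventProb, hmodels]
  cases pos <;> simp [PDB.literal, eventProb_compl, hprob]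

theorem Pr_union_of_disjoint (P : PDB ρ n) {Q Q' : CNF ρ} (h : Disjoint Q.symbols Q'.symbols) :
    Pr P (Q ∪ Q') = Pr P Q * Pr P Q' := by
  have hmodels : models n (Q ∪ Q') = models n Q ∩ models n Q' := Set.ext fun _ => CNF.holds_union
  rw [Pr_eq_eventProb, Pr_eq_eventProb, Pr_eq_eventProb, hmodels, groundAtoms_union,
    eventProb_inter (groundAtoms_disjoint h) (determinedBy_models Q) (determinedBy_models Q')]

theorem Pr_of_models_eq_union (P : PDB ρ n) {Q Q₁ Q₂ : CNF ρ}
    (h : Disjoint Q₁.symbols Q₂.symbols) (hQ : models n Q = models n Q₁ ∪ models n Q₂) :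
    Pr P Q = 1 - (1 - Pr P Q₁) * (1 - Pr P Q₂) := by
  have hcompl : (models n Q)ᶜ = (models n Q₁)ᶜ ∩ (models n Q₂)ᶜ := by rw [hQ, Set.compl_union]
  have hdet₁ := (determinedBy_models (n := n) Q₁).compl
  have hdet₂ := (determinedBy_models (n := n) Q₂).compl
  have hdet : DeterminedBy (groundAtoms n Q₁ ∪ groundAtoms n Q₂) (models n Q)ᶜ :=
    hcompl ▸ hdet₁.inter hdet₂
  calc Pr P Q
      = 1 - eventProb P.atom
          (groundAtoms n Q₁ ∪ groundAtoms n Q₂ ∪ groundAtoms n Q) (models n Q)ᶜ := by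
        rw [eventProb_compl, sub_sub_cancel,
          Pr_eq_eventProb_of_subset P Finset.subset_union_right]
    _ = 1 - eventProb P.atom (groundAtoms n Q₁ ∪ groundAtoms n Q₂)
          ((models n Q₁)ᶜ ∩ (models n Q₂)ᶜ) := by
        rw [eventProb_of_subset Finset.subset_union_left hdet, hcompl]
    _ = 1 - (1 - Pr P Q₁) * (1 - Pr P Q₂) := by
        rw [eventProb_inter (groundAtoms_disjoint h) hdet₁ hdet₂, eventProb_compl,
          eventProb_compl, Pr_eq_eventProb, Pr_eq_eventProb]

theorem models_conjunction (U : List (CNF ρ)) (s : Finset (Fin U.length)) :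
    models n (conjunction U s) = ⋂ i ∈ s, models n (U.get i) := by
  ext I
  simp only [mem_models, holds_conjunction, Set.mem_iInter]

theorem Pr_inclusion_exclusion (P : PDB ρ n) {Q : CNF ρ} {U : List (CNF ρ)}
    (hQ : models n Q = ⋃ i : Fin U.length, models n (U.get i)) :
    Pr P Q = ∑ s : Finset (Fin U.length) with s.Nonempty,
      (-1) ^ (s.card + 1) * Pr P (conjunction U s) := by
  let A := groundAtoms n Q ∪ Finset.univ.biUnion fun s => groundAtoms n (conjunction U s)
  have hA (s : Finset (Fin U.length)) : groundAtoms n (conjunction U s) ⊆ A :=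
    (Finset.subset_biUnion_of_mem (fun s => groundAtoms n (conjunction U s))
      (Finset.mem_univ s)).trans Finset.subset_union_right
  have h := eventProb_biUnion P.atom A Finset.univ fun i => models n (U.get i)
  simp only [Finset.mem_univ, Set.iUnion_true, ← hQ, ← models_conjunction,
    ← Pr_eq_eventProb_of_subset P (hA _), Finset.powerset_univ] at h
  rw [Pr_eq_eventProb_of_subset P Finset.subset_union_left, h]

theorem Pr_eq_sum_terms (hn : 1 ≤ n) (P : PDB ρ n) {Q : CNF ρ} {U T : List (CNF ρ)}
    (hQ : models n Q = ⋃ i : Fin U.length, models n (U.get i)) (hT : IsTermList U T) :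
    Pr P Q = (T.map fun q => coefficient U q * Pr P q).sum := by
  classical
  have : Std.Symm fun q q' : CNF ρ => ¬ Equivalent q q' := ⟨fun _ _ h h' => h h'.symm⟩
  have hnd : T.Nodup := hT.2.2.imp fun {q _} h => by
    rintro rfl
    exact h ⟨Entails.refl q, Entails.refl q⟩
  rw [Pr_inclusion_exclusion P hQ, ← List.sum_toFinset _ hnd, Finset.sum_filter]
  simp only [coefficient, Int.cast_sum, Finset.sum_mul]
  rw [Finset.sum_comm]
  refine Finset.sum_congr rfl fun s _ => ?_
  by_cases hs : s.Nonempty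
  · obtain ⟨q, hq, hsq⟩ := hT.2.1 s hs
    rw [Finset.sum_eq_single_of_mem q (List.mem_toFinset.2 hq)]
    · simp [hs, hsq, Pr_congr hn P hsq]
    · intro q' hq' hne
      have hnot : ¬ Equivalent (conjunction U s) q' := fun h =>
        hT.2.2.forall hq (List.mem_toFinset.1 hq') hne.symm (hsq.symm.trans h)
      simp [hnot]
  · simp [hs]

end Probability

/-! ## Separators -/

section Separator

/-- No atom of `Q` repeats a variable, a weakening of `CNF.Ranked`. -/
def CNF.RepetitionFree (Q : CNF ρ) : Prop := ∀ C ∈ Q, ∀ l ∈ C, l.args.Nodup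

/-- The ground atom obtained from `g` by inserting `a` at the position `pos` into its arguments. -/
def insertAtom {D : Type*} (pos : ρ → ℕ → ℕ) (a : D) (g : ρ × List D) : ρ × List D :=
  (g.1, g.2.insertIdx (pos g.1 (g.2.length + 1)) a)

/-- The counterpart of `PDB.restrict` for worlds: the part of `I` with `a` at the positions `pos`,
with that entry left out. -/
def World.restrict {D : Type*} (I : World ρ D) (pos : ρ → ℕ → ℕ) (a : D) : World ρ D :=
  fun R t => I R (t.insertIdx (pos R (t.length + 1)) a)

variable {D : Type*} {I : World ρ D} {Q Q' : CNF ρ} {pos : ρ → ℕ → ℕ}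
  {sep : (Clause ρ → ℕ) × (ρ → ℕ → ℕ)}

theorem CNF.Ranked.repetitionFree (h : Q.Ranked) : Q.RepetitionFree :=
  fun C hC l hl => (h C hC l hl).imp ne_of_lt

theorem CNF.RepetitionFree.mono (h : Q.RepetitionFree) (hsub : Q' ⊆ Q) : Q'.RepetitionFree :=
  fun C hC => h C (hsub hC)

theorem insertAtom_inj {a b : D} {g g' : ρ × List D} (hg : pos g.1 (g.2.length + 1) ≤ g.2.length)
    (hg' : pos g'.1 (g'.2.length + 1) ≤ g'.2.length) :
    insertAtom pos a g = insertAtom pos b g' ↔ a = b ∧ g = g' := by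
  refine ⟨fun h => ?_, fun h => h.1 ▸ h.2 ▸ rfl⟩
  obtain ⟨R, t⟩ := g
  obtain ⟨R', t'⟩ := g'
  simp only [insertAtom, Prod.mk.injEq] at h hg hg'
  obtain ⟨rfl, h⟩ := h
  have hlen : t.length = t'.length := by
    simpa only [List.length_insertIdx_of_le_length hg, List.length_insertIdx_of_le_length hg',
      add_left_inj] using congrArg List.length h
  rw [← hlen] at h
  have ha := congrArg (·[pos R (t.length + 1)]?) h
  have ht := congrArg (·.eraseIdx (pos R (t.length + 1))) h
  simp only [List.eraseIdx_insertIdx_self] at ht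
  simp only [List.getElem?_insertIdx_self, ← hlen, hg, if_true, Option.some.injEq] at ha
  exact ⟨ha, by rw [ht]⟩

theorem IsSeparator.lt_length (h : IsSeparator Q sep) {C : Clause ρ} (hC : C ∈ Q) {l : Literal ρ}
    (hl : l ∈ C) : sep.2 l.rel l.args.length < l.args.length :=
  (List.getElem?_eq_some_iff.1 (h C hC l hl)).1

theorem Literal.holds_iff_holds_restrict {l : Literal ρ} {x : ℕ}
    (hx : l.args[pos l.rel l.args.length]? = some x) (v : ℕ → D) :
    l.Holds I v ↔ Literal.Holds (I.restrict pos (v x)) v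
      ⟨l.pos, l.rel, l.args.eraseIdx (pos l.rel l.args.length)⟩ := by
  obtain ⟨hlt, rfl⟩ := List.getElem?_eq_some_iff.1 hx
  have hlen : ((l.args.eraseIdx (pos l.rel l.args.length)).map v).length + 1 = l.args.length := by
    rw [List.length_map, List.length_eraseIdx_of_lt hlt]
    omega
  simp only [Literal.Holds, World.restrict, hlen, ← List.map_insertIdx,
    List.insertIdx_eraseIdx_getElem hlt]

variable [DecidableEq ρ]

/-- If no atom repeats a variable, then the separator variable of a clause occurs in none of the
atoms that are left, so that their truth does not depend on its value. -/
theorem IsSeparator.holds_iff (h : IsSeparator Q sep) (hQ : Q.RepetitionFree) :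
    Q.Holds I ↔ ∀ a, (Q.instantiate sep.2).Holds (I.restrict sep.2 a) := by
  simp only [CNF.Holds, CNF.instantiate, Finset.forall_mem_image, Clause.Holds,
    Finset.exists_mem_image]
  refine ⟨fun hI a C hC v => ?_, fun hI C hC v => ?_⟩
  · obtain ⟨l, hl, hlI⟩ := hI C hC (Function.update v (sep.1 C) a)
    refine ⟨l, hl, ?_⟩
    have hx := h C hC l hl
    rw [Literal.holds_iff_holds_restrict hx, Function.update_self, Literal.Holds] at hlI
    rwa [Literal.Holds, ← List.map_congr_left (f := Function.update v (sep.1 C) a)]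
    intro y hy
    refine Function.update_of_ne ?_ _ _
    rintro rfl
    obtain ⟨i, hi, hiy⟩ := List.mem_eraseIdx_iff_getElem?.1 hy
    exact hi ((List.getElem?_inj (List.getElem?_eq_some_iff.1 hiy).1 (hQ C hC l hl)).1
      (hiy.trans hx.symm))
  · obtain ⟨l, hl, hlI⟩ := hI (v (sep.1 C)) hC v
    exact ⟨l, hl, (Literal.holds_iff_holds_restrict (h C hC l hl) v).2 hlI⟩

theorem IsSeparator.symbols_instantiate (h : IsSeparator Q sep) {R : ρ} {k : ℕ}
    (hk : (R, k) ∈ (Q.instantiate sep.2).symbols) :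
    (R, k + 1) ∈ Q.symbols ∧ sep.2 R (k + 1) ≤ k := by
  simp only [CNF.instantiate, CNF.mem_symbols, Finset.exists_mem_image] at hk
  obtain ⟨C, hC, l, hl, hs⟩ := hk
  have hlt := h.lt_length hC hl
  simp only [Literal.symbol, List.length_eraseIdx_of_lt hlt, Prod.mk.injEq] at hs
  obtain ⟨rfl, rfl⟩ := hs
  rw [Nat.sub_add_cancel (by omega)]
  exact ⟨CNF.symbol_mem_symbols hC hl, by omega⟩

variable {n : ℕ}

theorem IsSeparator.insertAtom_mem_groundAtoms (h : IsSeparator Q sep) (a : Fin n)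
    {g : ρ × List (Fin n)} (hg : g ∈ groundAtoms n (Q.instantiate sep.2)) :
    insertAtom sep.2 a g ∈ groundAtoms n Q := by
  obtain ⟨hmem, hle⟩ := h.symbols_instantiate (mem_groundAtoms.1 hg)
  rw [mem_groundAtoms]
  simpa only [insertAtom, List.length_insertIdx_of_le_length hle] using hmem

theorem IsSeparator.insertAtom_inj (h : IsSeparator Q sep) {a b : Fin n}
    {g g' : ρ × List (Fin n)} (hg : g ∈ groundAtoms n (Q.instantiate sep.2))
    (hg' : g' ∈ groundAtoms n (Q.instantiate sep.2)) :
    insertAtom sep.2 a g = insertAtom sep.2 b g' ↔ a = b ∧ g = g' :=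
  LiftR.insertAtom_inj (h.symbols_instantiate (mem_groundAtoms.1 hg)).2
    (h.symbols_instantiate (mem_groundAtoms.1 hg')).2

theorem IsSeparator.pairwiseDisjoint_image_insertAtom (h : IsSeparator Q sep) :
    ((Finset.univ : Finset (Fin n)) : Set (Fin n)).PairwiseDisjoint fun a =>
      (groundAtoms n (Q.instantiate sep.2)).image (insertAtom sep.2 a) := by
  intro a _ b _ hab
  refine Finset.disjoint_left.2 fun g' hga hgb => ?_
  obtain ⟨g, hg, rfl⟩ := Finset.mem_image.1 hga
  obtain ⟨g', hg', heq⟩ := Finset.mem_image.1 hgb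
  exact hab ((h.insertAtom_inj hg' hg).1 heq).1.symm

theorem determinedBy_image_insertAtom (Q : CNF ρ) (pos : ρ → ℕ → ℕ) (a : Fin n) :
    DeterminedBy ((groundAtoms n Q).image (insertAtom pos a))
      {I | Q.Holds (World.restrict (fun R t => (R, t) ∈ I) pos a)} :=
  fun _ => holds_congr_groundAtoms fun _ hg => by
    simp only [World.restrict, Finset.mem_inter, and_iff_left_iff_imp]
    exact fun _ => Finset.mem_image_of_mem (insertAtom pos a) hg

theorem IsSeparator.eventProb_image_insertAtom (h : IsSeparator Q sep) (P : PDB ρ n) (a : Fin n) :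
    eventProb P.atom ((groundAtoms n (Q.instantiate sep.2)).image (insertAtom sep.2 a))
        {I | (Q.instantiate sep.2).Holds (World.restrict (fun R t => (R, t) ∈ I) sep.2 a)} =
      Pr (P.restrict sep.2 a) (Q.instantiate sep.2) := by
  have hinj : Set.InjOn (insertAtom sep.2 a) (groundAtoms n (Q.instantiate sep.2)) :=
    fun g hg g' hg' heq => ((h.insertAtom_inj hg hg').1 heq).2
  rw [eventProb_image _ hinj, Pr_eq_eventProb]
  refine eventProb_congr fun I hI => holds_congr_groundAtoms fun g hg => ?_
  exact Finset.mem_coe.symm.trans <| by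
    rw [Finset.coe_image]
    exact hinj.mem_image_iff (Finset.coe_subset.2 hI) hg

theorem Pr_separator (P : PDB ρ n) (hQ : Q.RepetitionFree) (h : IsSeparator Q sep) :
    Pr P Q = ∏ a : Fin n, Pr (P.restrict sep.2 a) (Q.instantiate sep.2) := by
  have hmodels : models n Q = ⋂ a ∈ (Finset.univ : Finset (Fin n)),
      {I | (Q.instantiate sep.2).Holds (World.restrict (fun R t => (R, t) ∈ I) sep.2 a)} := by
    ext I
    simp only [mem_models, h.holds_iff hQ, Finset.mem_univ, Set.iInter_true, Set.mem_iInter,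
      Set.mem_ofPred_eq]
  have hdet (a : Fin n) := determinedBy_image_insertAtom (Q.instantiate sep.2) sep.2 a
  have hsub : (Finset.univ.biUnion fun a : Fin n =>
      (groundAtoms n (Q.instantiate sep.2)).image (insertAtom sep.2 a)) ⊆ groundAtoms n Q :=
    Finset.biUnion_subset.2 fun a _ => Finset.image_subset_iff.2 fun _ hg =>
      h.insertAtom_mem_groundAtoms a hg
  rw [Pr_eq_eventProb, hmodels, eventProb_of_subset hsub (.biInter fun a _ => hdet a),
    eventProb_biInter h.pairwiseDisjoint_image_insertAtom fun a _ => hdet a]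
  exact Finset.prod_congr rfl fun a _ => h.eventProb_image_insertAtom P a

end Separator

/-! ## The queries of the recursive calls -/

section RecursiveCalls

variable {Q Q' R : CNF ρ}

/-- The largest number of literals of a clause of `Q`. -/
def CNF.width (Q : CNF ρ) : ℕ := Q.sup Finset.card

theorem CNF.card_le_width {C : Clause ρ} (hC : C ∈ Q) : C.card ≤ Q.width :=
  Finset.le_sup (f := Finset.card) hC

variable [DecidableEq ρ] {U : List (CNF ρ)} {simplify : CNF ρ → CNF ρ}
  {sep : (Clause ρ → ℕ) × (ρ → ℕ → ℕ)}

/-- The clauses of `Q'` are not longer than those of `Q` and have no further predicate symbols.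
Up to equivalence, only finitely many clauses are allowed in such a `Q'`. -/
def CNF.IsBoundedBy (Q' Q : CNF ρ) : Prop :=
  ∀ C ∈ Q', C.card ≤ Q.width ∧ ∀ l ∈ C, l.symbol ∈ Q.symbols

theorem CNF.isBoundedBy_self (Q : CNF ρ) : Q.IsBoundedBy Q := fun _ hC =>
  ⟨CNF.card_le_width hC, fun _ hl => CNF.symbol_mem_symbols hC hl⟩

theorem CNF.IsBoundedBy.width_le (h : Q'.IsBoundedBy Q) : Q'.width ≤ Q.width :=
  Finset.sup_le fun C hC => (h C hC).1

theorem CNF.IsBoundedBy.symbols_subset (h : Q'.IsBoundedBy Q) : Q'.symbols ⊆ Q.symbols :=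
  fun s hs => by
    obtain ⟨C, hC, l, hl, rfl⟩ := CNF.mem_symbols.1 hs
    exact (h C hC).2 l hl

theorem CNF.maxArity_mono (h : Q'.symbols ⊆ Q.symbols) : Q'.maxArity ≤ Q.maxArity :=
  Finset.sup_mono h

theorem CNF.symbols_nonempty (hne : Q ≠ ∅) (hemp : ∅ ∉ Q) : Q.symbols.Nonempty := by
  obtain ⟨C, hC⟩ := Finset.nonempty_iff_ne_empty.2 hne
  obtain ⟨l, hl⟩ := Finset.nonempty_iff_ne_empty.2 (ne_of_mem_of_not_mem hC hemp)
  exact ⟨_, CNF.symbol_mem_symbols hC hl⟩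

theorem IsSimplification.repetitionFree (h : IsSimplification Q R) (hQ : Q.RepetitionFree) :
    R.RepetitionFree := fun C hC l hl =>
  let ⟨C', hC', hsub⟩ := h.2.1 C hC
  hQ C' hC' l (hsub hl)

theorem IsSimplification.isBoundedBy (h : IsSimplification Q R) (hQ : Q.IsBoundedBy Q') :
    R.IsBoundedBy Q' := fun C hC =>
  let ⟨C', hC', hsub⟩ := h.2.1 C hC
  ⟨(Finset.card_le_card hsub).trans (hQ C' hC').1, fun l hl => (hQ C' hC').2 l (hsub hl)⟩

/-! ## Members of a union-CNF -/

theorem mem_or_exists_component_of_mem_distribute {𝒞 : Finset (Clause ρ)} {d : CNF ρ}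
    (hd : d ∈ distribute 𝒞 Q) {E : Clause ρ} (hE : E ∈ d) :
    E ∈ Q ∨ ∃ C ∈ 𝒞, E ∈ components C := by
  obtain ⟨f, hf, rfl⟩ := Finset.mem_image.1 hd
  refine (Finset.mem_union.1 hE).imp_right fun hE => ?_
  obtain ⟨⟨C, hC⟩, -, rfl⟩ := Finset.mem_image.1 hE
  exact ⟨C, hC, Finset.mem_pi.1 hf C hC⟩

theorem IsSplitting.repetitionFree {C E : Clause ρ} (h : IsSplitting Q C)
    (hE : E ∈ components C) : ∀ l ∈ E, l.args.Nodup := fun l hl =>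
  (h.1 l ((mem_components.1 hE).1.1 hl)).imp ne_of_lt

theorem Subsumes.symbol_mem {C E : Clause ρ} (h : Subsumes E C) (hC : C ∈ Q) {l : Literal ρ}
    (hl : l ∈ E) : l.symbol ∈ Q.symbols := by
  obtain ⟨⟨σ, hσ⟩, -⟩ := h
  have hsymbol : (l.rename σ).symbol = l.symbol := by
    simp only [Literal.symbol, Literal.rename, List.length_map]
  exact hsymbol ▸ CNF.symbol_mem_symbols hC (hσ (Finset.mem_image_of_mem _ hl))

theorem IsUnionCNF.repetitionFree (hs : ∀ Q, IsSimplification Q (simplify Q))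
    (hU : IsUnionCNF simplify Q U) (hQ : Q.RepetitionFree) : ∀ q ∈ U, q.RepetitionFree := by
  obtain ⟨𝒞, h𝒞, -, hmem, -⟩ := hU
  intro q hq
  obtain ⟨d, hd, rfl⟩ := hmem q hq
  refine (hs d).repetitionFree fun E hE => ?_
  obtain hE | ⟨C, hC, hE⟩ := mem_or_exists_component_of_mem_distribute hd hE
  · exact hQ E hE
  · exact (h𝒞 C hC).repetitionFree hE

theorem IsUnionCNF.isBoundedBy (hs : ∀ Q, IsSimplification Q (simplify Q))
    (hU : IsUnionCNF simplify Q U) : ∀ q ∈ U, q.IsBoundedBy Q := by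
  obtain ⟨𝒞, h𝒞, -, hmem, -⟩ := hU
  intro q hq
  obtain ⟨d, hd, rfl⟩ := hmem q hq
  refine (hs d).isBoundedBy fun E hE => ?_
  obtain hE | ⟨C, hC, hE⟩ := mem_or_exists_component_of_mem_distribute hd hE
  · exact Q.isBoundedBy_self E hE
  · obtain ⟨C', hC', hsub⟩ := (h𝒞 C hC).2.2.2 E hE
    exact ⟨hsub.2.trans (CNF.card_le_width hC'), fun l hl => hsub.symbol_mem hC' hl⟩

theorem IsUnionCNF.entails (hs : ∀ Q, IsSimplification Q (simplify Q))
    (hU : IsUnionCNF simplify Q U) : ∀ q ∈ U, Entails q Q := by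
  obtain ⟨𝒞, -, -, hmem, -⟩ := hU
  intro q hq
  obtain ⟨d, hd, rfl⟩ := hmem q hq
  refine (hs d).1.2.trans fun D _ I hI C hC => hI C ?_
  obtain ⟨f, -, rfl⟩ := Finset.mem_image.1 hd
  exact Finset.mem_union_left _ hC

/-- In a world satisfying `Q`, each splitting clause has a true component; these components give
the member of the union that is true. -/
theorem IsUnionCNF.exists_holds (hU : IsUnionCNF simplify Q U) {D : Type} [Nonempty D]
    {I : World ρ D} (hI : Q.Holds I) : ∃ q ∈ U, q.Holds I := by
  obtain ⟨𝒞, h𝒞, -, -, hcover, -⟩ := hU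
  have hcomponent (C : Clause ρ) : ∃ S, C ∈ 𝒞 → S ∈ components C ∧ Clause.Holds I S := by
    by_cases hC : C ∈ 𝒞
    · obtain ⟨S, hS⟩ := (holds_iff_exists_component I C).1
        ((h𝒞 C hC).2.1.1 D I hI C (Finset.mem_singleton_self _))
      exact ⟨S, fun _ => hS⟩
    · exact ⟨∅, fun h => absurd h hC⟩
  choose f hf using hcomponent
  obtain ⟨q, hq, hdq⟩ := hcover _ (Finset.mem_image_of_mem _
    (Finset.mem_pi.2 fun C hC => (hf C hC).1 : (fun C _ => f C) ∈ 𝒞.pi fun C => components C))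
  refine ⟨q, hq, hdq D I (CNF.holds_union.2 ⟨hI, fun E hE => ?_⟩)⟩
  obtain ⟨⟨C, hC⟩, -, rfl⟩ := Finset.mem_image.1 hE
  exact (hf C hC).2

theorem IsUnionCNF.holds_iff (hs : ∀ Q, IsSimplification Q (simplify Q))
    (hU : IsUnionCNF simplify Q U) {D : Type} [Nonempty D] {I : World ρ D} :
    Q.Holds I ↔ ∃ q ∈ U, q.Holds I :=
  ⟨hU.exists_holds, fun ⟨q, hq, h⟩ => hU.entails hs q hq D I h⟩

theorem IsUnionCNF.exists_not_entails (hU : IsUnionCNF simplify Q U) (hlen : 1 < U.length)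
    {q : CNF ρ} (hq : q ∈ U) : ∃ q' ∈ U, ¬ Entails q q' ∧ ¬ Entails q' q := by
  obtain ⟨-, -, -, -, -, hp⟩ := hU
  rw [List.pairwise_iff_getElem] at hp
  obtain ⟨i, hi, rfl⟩ := List.getElem_of_mem hq
  rcases Nat.eq_zero_or_pos i with rfl | hi0
  · exact ⟨U[1], List.getElem_mem _, hp 0 1 hi hlen Nat.zero_lt_one⟩
  · exact ⟨U[0], List.getElem_mem _, (hp 0 i (by omega) hi hi0).symm⟩

theorem IsUnionCNF.not_entails (hs : ∀ Q, IsSimplification Q (simplify Q))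
    (hU : IsUnionCNF simplify Q U) (hlen : 1 < U.length) {q : CNF ρ} (hq : q ∈ U) :
    ¬ Entails Q q := fun h =>
  let ⟨q', hq', _, hnot⟩ := hU.exists_not_entails hlen hq
  hnot ((hU.entails hs q' hq').trans h)

theorem IsUnionCNF.symbols_nonempty (hU : IsUnionCNF simplify Q U) (hlen : 1 < U.length)
    {q : CNF ρ} (hq : q ∈ U) : q.symbols.Nonempty := by
  obtain ⟨q', -, hqq', hq'q⟩ := hU.exists_not_entails hlen hq
  refine CNF.symbols_nonempty ?_ fun hemp => ?_
  · rintro rfl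
    exact hq'q fun _ _ _ _ => CNF.holds_empty
  · exact hqq' fun _ _ _ hI => absurd hI (CNF.not_holds_of_empty_mem hemp)

theorem CNF.RepetitionFree.conjunction (h : ∀ q ∈ U, q.RepetitionFree)
    (s : Finset (Fin U.length)) : (conjunction U s).RepetitionFree := fun C hC =>
  let ⟨i, _, hi⟩ := Finset.mem_biUnion.1 hC
  h _ (List.get_mem U i) C hi

theorem CNF.IsBoundedBy.conjunction (h : ∀ q ∈ U, q.IsBoundedBy Q) (s : Finset (Fin U.length)) :
    (conjunction U s).IsBoundedBy Q := fun C hC =>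
  let ⟨i, _, hi⟩ := Finset.mem_biUnion.1 hC
  h _ (List.get_mem U i) C hi

theorem conjunction_entails {s : Finset (Fin U.length)} {i : Fin U.length} (hi : i ∈ s) :
    Entails (conjunction U s) (U.get i) := fun _ _ _ h => holds_conjunction.1 h i hi

theorem forall_mem_disjunction {p : Literal ρ → Prop} (hp : ∀ m l, p l → p (l.rename (· + m)))
    (h : ∀ q ∈ U, ∀ C ∈ q, ∀ l ∈ C, p l) : ∀ C ∈ disjunction U, ∀ l ∈ C, p l := by
  induction U with
  | nil =>
    intro C hC l hl
    rw [Finset.mem_singleton.1 hC] at hl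
    exact absurd hl (Finset.notMem_empty l)
  | cons q U ih =>
    intro C hC l hl
    obtain ⟨C₁, hC₁, C₂, hC₂, rfl⟩ := Finset.mem_image₂.1 hC
    rcases Finset.mem_union.1 hl with hl | hl
    · exact h q List.mem_cons_self C₁ hC₁ l hl
    · obtain ⟨l, hl', rfl⟩ := Finset.mem_image.1 hl
      exact hp _ _ (ih (fun q hq => h q (List.mem_cons_of_mem _ hq)) C₂ hC₂ l hl')

theorem CNF.RepetitionFree.disjunction (h : ∀ q ∈ U, q.RepetitionFree) :
    (disjunction U).RepetitionFree :=
  forall_mem_disjunction (fun m _ hl => hl.map (add_left_injective m)) h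

theorem exists_mem_symbols_of_mem_disjunction {s : ρ × ℕ} (hs : s ∈ (disjunction U).symbols) :
    ∃ q ∈ U, s ∈ q.symbols := by
  obtain ⟨C, hC, l, hl, rfl⟩ := CNF.mem_symbols.1 hs
  refine forall_mem_disjunction (p := fun l => ∃ q ∈ U, l.symbol ∈ q.symbols) (fun m l hl => ?_)
    (fun q hq C hC l hl => ⟨q, hq, CNF.symbol_mem_symbols hC hl⟩) C hC l hl
  simpa only [Literal.symbol, Literal.rename, List.length_map] using hl

theorem disjoint_symbols_disjunction {V : List (CNF ρ)}
    (h : ∀ q ∈ U, ∀ q' ∈ V, Disjoint q.symbols q'.symbols) :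
    Disjoint (disjunction U).symbols (disjunction V).symbols := by
  refine Finset.disjoint_left.2 fun s hs hs' => ?_
  obtain ⟨q, hq, hsq⟩ := exists_mem_symbols_of_mem_disjunction hs
  obtain ⟨q', hq', hsq'⟩ := exists_mem_symbols_of_mem_disjunction hs'
  exact Finset.disjoint_left.1 (h q hq q' hq') hsq hsq'

theorem symbols_disjunction_ssubset {Sy : Finset (ρ × ℕ)} (h : ∀ q ∈ U, q.symbols ⊆ Sy)
    (h' : Q'.symbols ⊆ Sy) (hne : Q'.symbols.Nonempty)
    (hd : ∀ q ∈ U, Disjoint q.symbols Q'.symbols) : (disjunction U).symbols ⊂ Sy := by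
  obtain ⟨s, hs⟩ := hne
  refine (Finset.ssubset_iff_of_subset fun r hr => ?_).2 ⟨s, h' hs, fun hr => ?_⟩ <;>
    obtain ⟨q, hq, hrq⟩ := exists_mem_symbols_of_mem_disjunction hr
  · exact h q hq hrq
  · exact Finset.disjoint_left.1 (hd q hq) hrq hs

theorem CNF.RepetitionFree.instantiate (h : Q.RepetitionFree) (pos : ρ → ℕ → ℕ) :
    (Q.instantiate pos).RepetitionFree := by
  simp only [CNF.RepetitionFree, CNF.instantiate, Finset.forall_mem_image]
  exact fun C hC l hl => (h C hC l hl).sublist (List.eraseIdx_sublist _ _)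

theorem IsSeparator.maxArity_instantiate_lt (h : IsSeparator Q sep) (hne : Q.symbols.Nonempty) :
    (Q.instantiate sep.2).maxArity < Q.maxArity := by
  have hlt (s : ρ × ℕ) (hs : s ∈ (Q.instantiate sep.2).symbols) : s.2 < Q.maxArity :=
    Nat.lt_of_succ_le (Finset.le_sup (f := Prod.snd) (h.symbols_instantiate hs).1)
  refine (Finset.sup_lt_iff ?_).2 hlt
  obtain ⟨s, hs⟩ := hne
  obtain ⟨C, hC, l, hl, rfl⟩ := CNF.mem_symbols.1 hs
  exact (Nat.zero_le _).trans_lt ((h.lt_length hC hl).trans_le (Finset.le_sup (f := Prod.snd) hs))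

theorem IsSeparator.card_symbols_instantiate_le (h : IsSeparator Q sep) :
    (Q.instantiate sep.2).symbols.card ≤ Q.symbols.card :=
  Finset.card_le_card_of_injOn (fun s => (s.1, s.2 + 1))
    (fun s hs => (h.symbols_instantiate (k := s.2) hs).1)
    (Function.injective_id.prodMap (add_left_injective 1)).injOn

end RecursiveCalls

/-! ## Termination -/

section Termination

variable {Q Q' : CNF ρ}

open Classical in
/-- The members of `B` that `Q` does not entail. The stronger `Q`, the fewer they are, which is what
bounds a chain of strengthenings. -/
noncomputable def CNF.unentailed (Q : CNF ρ) (B : Finset (Clause ρ)) : Finset (Clause ρ) :=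
  B.filter fun C => ¬ Entails Q {C}

theorem CNF.mem_unentailed {B : Finset (Clause ρ)} {C : Clause ρ} :
    C ∈ Q.unentailed B ↔ C ∈ B ∧ ¬ Entails Q {C} := by
  simp only [CNF.unentailed, Finset.mem_filter]

theorem CNF.unentailed_subset_of_entails (h : Entails Q' Q) (B : Finset (Clause ρ)) :
    Q'.unentailed B ⊆ Q.unentailed B := fun _ hC =>
  CNF.mem_unentailed.2 ((CNF.mem_unentailed.1 hC).imp_right fun hnot hQ => hnot (h.trans hQ))

variable [DecidableEq ρ]

/-- Representatives, up to equivalence, of the clauses with at most `M` literals over the predicate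
symbols `Sy`. -/
noncomputable def testClauses (Sy : Finset (ρ × ℕ)) (M : ℕ) : Finset (Clause ρ) :=
  (exists_small_clauses Sy M).choose

/-- The measure that decreases, lexicographically, along the recursive calls: each call lowers the
sum of the maximal arity and the number of predicate symbols, or strengthens the query without
new predicate symbols or longer clauses. -/
noncomputable def CNF.rank (Q : CNF ρ) : ℕ ×ₗ ℕ ×ₗ ℕ :=
  toLex (Q.maxArity + Q.symbols.card,
    toLex (Q.width, (Q.unentailed (testClauses Q.symbols Q.width)).card))

theorem exists_mem_testClauses (h : Q.IsBoundedBy Q') {C : Clause ρ} (hC : C ∈ Q) :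
    ∃ C' ∈ testClauses Q'.symbols Q'.width, Equivalent {C} {C'} :=
  (exists_small_clauses Q'.symbols Q'.width).choose_spec C (h C hC).1 (h C hC).2

theorem CNF.unentailed_testClauses_ssubset (hbound : Q'.IsBoundedBy Q) (h : Entails Q' Q)
    (hnot : ¬ Entails Q Q') :
    Q'.unentailed (testClauses Q.symbols Q.width) ⊂
      Q.unentailed (testClauses Q.symbols Q.width) := by
  have hclause : ∃ C ∈ Q', ¬ Entails Q {C} := by
    by_contra! hall
    exact hnot fun D _ I hI C hC => CNF.holds_singleton.1 (hall C hC D I hI)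
  obtain ⟨C, hC, hQC⟩ := hclause
  obtain ⟨B, hB, hCB⟩ := exists_mem_testClauses hbound hC
  have hQ'C : Entails Q' {C} := fun D _ I hI => CNF.holds_singleton.2 (hI C hC)
  refine (Finset.ssubset_iff_of_subset (CNF.unentailed_subset_of_entails h _)).2 ⟨B, ?_, ?_⟩
  · exact CNF.mem_unentailed.2 ⟨hB, fun hQB => hQC (hQB.trans hCB.2)⟩
  · exact fun hmem => (CNF.mem_unentailed.1 hmem).2 (hQ'C.trans hCB.1)

theorem CNF.rank_lt_of_add_lt
    (h : Q'.maxArity + Q'.symbols.card < Q.maxArity + Q.symbols.card) : Q'.rank < Q.rank :=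
  Prod.Lex.toLex_lt_toLex.2 (.inl h)

theorem CNF.rank_lt_of_symbols_ssubset (h : Q'.symbols ⊂ Q.symbols) : Q'.rank < Q.rank :=
  CNF.rank_lt_of_add_lt (add_lt_add_of_le_of_lt (CNF.maxArity_mono h.1) (Finset.card_lt_card h))

theorem CNF.IsBoundedBy.add_card_symbols_le (h : Q'.IsBoundedBy Q) :
    Q'.maxArity + Q'.symbols.card ≤ Q.maxArity + Q.symbols.card :=
  add_le_add (CNF.maxArity_mono h.symbols_subset) (Finset.card_le_card h.symbols_subset)

theorem CNF.IsBoundedBy.symbols_eq (h : Q'.IsBoundedBy Q)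
    (heq : Q'.maxArity + Q'.symbols.card = Q.maxArity + Q.symbols.card) :
    Q'.symbols = Q.symbols := by
  have harity := CNF.maxArity_mono h.symbols_subset
  exact Finset.eq_of_subset_of_card_le h.symbols_subset (by omega)

theorem CNF.IsBoundedBy.rank_le (hbound : Q'.IsBoundedBy Q) (h : Entails Q' Q) :
    Q'.rank ≤ Q.rank := by
  refine Prod.Lex.toLex_le_toLex'.2 ⟨hbound.add_card_symbols_le, fun heq =>
    Prod.Lex.toLex_le_toLex'.2 ⟨hbound.width_le, fun hwidth => ?_⟩⟩
  rw [hbound.symbols_eq heq, show Q'.width = Q.width from hwidth]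
  exact Finset.card_le_card (CNF.unentailed_subset_of_entails h _)

theorem CNF.IsBoundedBy.rank_lt (hbound : Q'.IsBoundedBy Q) (h : Entails Q' Q)
    (hnot : ¬ Entails Q Q') : Q'.rank < Q.rank := by
  refine Prod.Lex.toLex_lt_toLex'.2 ⟨hbound.add_card_symbols_le, fun heq =>
    Prod.Lex.toLex_lt_toLex'.2 ⟨hbound.width_le, fun hwidth => ?_⟩⟩
  rw [hbound.symbols_eq heq, show Q'.width = Q.width from hwidth]
  exact Finset.card_lt_card (CNF.unentailed_testClauses_ssubset hbound h hnot)

end Termination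

/-! ## Failure and success uniformly in the database -/

section Procedures

open Filter

/-- A computation with input a database, over a domain of arbitrary size, as a function of the
recursion depth that it is allowed to use. -/
abbrev Procedure (ρ : Type*) := ℕ → ∀ n, PDB ρ n → Outcome

/-- With any sufficiently large recursion depth, which must not depend on the domain or the
database, `o` halts with answer FAIL on all databases over nonempty domains. -/
def Procedure.Fails (o : Procedure ρ) : Prop :=
  ∀ᶠ d in atTop, ∀ n, 1 ≤ n → ∀ P, ∃ t, o d n P = .fail t

/-- With any sufficiently large recursion depth, which must not depend on the domain or the
database, `o` computes `v` on all databases over nonempty domains, in time `O(n ^ k)`. -/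
def Procedure.Returns (k : ℕ) (o : Procedure ρ) (v : ∀ n, PDB ρ n → ℝ) : Prop :=
  ∃ c, ∀ᶠ d in atTop, ∀ n, 1 ≤ n → ∀ P, ∃ t, o d n P = .value (v n P) t ∧ t ≤ c * n ^ k

/-- The alternative of the theorem: `o` fails on all databases, or computes `v` on all of them. -/
def Procedure.Settles (k : ℕ) (o : Procedure ρ) (v : ∀ n, PDB ρ n → ℝ) : Prop :=
  o.Fails ∨ o.Returns k v

namespace Procedure

variable {k k' : ℕ} {o : Procedure ρ} {v w : ∀ n, PDB ρ n → ℝ}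

theorem le_mul_pow {n : ℕ} (hn : 1 ≤ n) (m k : ℕ) : m ≤ m * n ^ k :=
  Nat.le_mul_of_pos_right m (Nat.pow_pos hn)

theorem Settles.mono (h : Settles k o v) (hk : k ≤ k') : Settles k' o v := by
  refine h.imp_right fun ⟨c, h⟩ => ⟨c, h.mono fun d h n hn P => ?_⟩
  obtain ⟨t, ht, hle⟩ := h n hn P
  exact ⟨t, ht, hle.trans (Nat.mul_le_mul_left c (Nat.pow_le_pow_right hn hk))⟩

theorem Settles.congr (h : Settles k o v) (hv : ∀ n, 1 ≤ n → ∀ P, v n P = w n P) :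
    Settles k o w := by
  refine h.imp_right fun ⟨c, h⟩ => ⟨c, h.mono fun d h n hn P => ?_⟩
  exact hv n hn P ▸ h n hn P

theorem settles_value (k : ℕ) (v : ∀ n, PDB ρ n → ℝ) (m : ℕ) :
    Settles k (fun _ n P => .value (v n P) m) v :=
  .inr ⟨m, .of_forall fun _ _ hn _ => ⟨m, rfl, le_mul_pow hn m k⟩⟩

theorem settles_fail (k m : ℕ) (v : ∀ n, PDB ρ n → ℝ) : Settles k (fun _ _ _ => .fail m) v :=
  .inl (.of_forall fun _ _ _ _ => ⟨m, rfl⟩)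

theorem Settles.delay (h : Settles k o v) (m : ℕ) :
    Settles k (fun d n P => (o d n P).delay m) v := by
  refine h.imp (fun h => h.mono fun d h n hn P => ?_)
    fun ⟨c, h⟩ => ⟨m + c, h.mono fun d h n hn P => ?_⟩
  · obtain ⟨t, ht⟩ := h n hn P
    exact ⟨m + t, by simp only [ht, Outcome.delay]⟩
  · obtain ⟨t, ht, hle⟩ := h n hn P
    refine ⟨m + t, by simp only [ht, Outcome.delay], ?_⟩
    rw [add_mul]
    exact Nat.add_le_add (le_mul_pow hn m k) hle

theorem Settles.of_succ (h : Settles k (fun d => o (d + 1)) v) : Settles k o v := by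
  rw [Settles, Fails, Returns, ← map_add_atTop_eq_nat 1]
  exact h

/-- It suffices that the continuation settles on the correct intermediate value. -/
theorem Settles.bind {g : ℕ → ∀ n, PDB ρ n → ℝ → Outcome} (h : Settles k o v)
    (hg : Settles k (fun d n P => g d n P (v n P)) w) :
    Settles k (fun d n P => (o d n P).bind (g d n P)) w := by
  rcases h with h | ⟨c, h⟩
  · refine .inl (h.mono fun d h n hn P => ?_)
    obtain ⟨t, ht⟩ := h n hn P
    exact ⟨t, by simp only [ht, Outcome.bind]⟩
  refine hg.imp (fun hg => ?_) fun ⟨c', hg⟩ => ⟨c + c', ?_⟩ <;>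
    filter_upwards [h, hg] with d h hg n hn P <;>
    obtain ⟨t, ht, hle⟩ := h n hn P
  · obtain ⟨t', ht'⟩ := hg n hn P
    exact ⟨t + t', by simp only [ht, Outcome.bind, ht', Outcome.delay]⟩
  · obtain ⟨t', ht', hle'⟩ := hg n hn P
    refine ⟨t + t', by simp only [ht, Outcome.bind, ht', Outcome.delay], ?_⟩
    rw [add_mul]
    exact Nat.add_le_add hle hle'

theorem settles_fold {ι : Type*} (op : ℝ → ℝ → ℝ) (init : ℝ) {L : List ι}
    {o : ι → Procedure ρ} {v : ι → ∀ n, PDB ρ n → ℝ} (h : ∀ i ∈ L, Settles k (o i) (v i)) :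
    Settles k (fun d n P => Outcome.fold op init (L.map fun i => o i d n P))
      (fun n P => (L.map fun i => v i n P).foldr op init) := by
  induction L with
  | nil => exact settles_value k (fun _ _ => init) 0
  | cons i L ih =>
    exact (h i List.mem_cons_self).bind
      ((ih fun j hj => h j (List.mem_cons_of_mem _ hj)).bind (settles_value k _ 1))

theorem exists_fold_map_eq_value {ι : Type*} (op : ℝ → ℝ → ℝ) (init : ℝ) {b : ℕ} {w : ι → ℝ}
    {o : ι → Outcome} (h : ∀ i, ∃ t, o i = .value (w i) t ∧ t ≤ b) (L : List ι) :
    ∃ t, Outcome.fold op init (L.map o) = .value ((L.map w).foldr op init) t ∧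
      t ≤ L.length * (b + 1) := by
  induction L with
  | nil => exact ⟨0, rfl, Nat.zero_le _⟩
  | cons i L ih =>
    obtain ⟨t, ht, hle⟩ := h i
    obtain ⟨t', ht', hle'⟩ := ih
    refine ⟨t + (t' + 1), ?_, ?_⟩
    · simp only [List.map_cons, List.foldr_cons, Outcome.fold, ht, ht', Outcome.bind,
        Outcome.delay]
    · rw [List.length_cons, add_mul, one_mul]
      omega

/-- The `n` calls, each in time `O(n ^ k)`, are the only source of a larger exponent. -/
theorem Settles.prod_restrict (h : Settles k o v) (pos : ρ → ℕ → ℕ) :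
    Settles (k + 1)
      (fun d n P => Outcome.fold (· * ·) 1
        ((List.finRange n).map fun a => o d n (P.restrict pos a)))
      (fun n P => ∏ a : Fin n, v n (P.restrict pos a)) := by
  refine h.imp (fun h => h.mono fun d h n hn P => ?_)
    fun ⟨c, h⟩ => ⟨c + 1, h.mono fun d h n hn P => ?_⟩
  · obtain ⟨m, rfl⟩ := Nat.exists_eq_add_of_le' hn
    obtain ⟨t, ht⟩ := h _ hn (P.restrict pos 0)
    exact ⟨t, by simp only [List.finRange_succ, List.map_cons, Outcome.fold, ht, Outcome.bind]⟩
  · obtain ⟨t, ht, hle⟩ := exists_fold_map_eq_value (· * ·) 1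
      (fun a => h n hn (P.restrict pos a)) (List.finRange n)
    refine ⟨t, by simp only [ht, Fin.prod_univ_def, List.prod], ?_⟩
    calc t ≤ n * (c * n ^ k + 1) := by simpa only [List.length_finRange] using hle
      _ ≤ n * (c * n ^ k + 1 * n ^ k) := by gcongr; exact le_mul_pow hn 1 k
      _ = (c + 1) * n ^ (k + 1) := by ring

end Procedure

end Procedures

/-! ## The rules of the algorithm -/

section Algorithm

open Procedure

theorem sum_map_filter_eq {ι : Type*} {p : ι → Bool} {f : ι → ℝ} (h : ∀ i, p i = false → f i = 0)
    (L : List ι) : ((L.filter p).map f).sum = (L.map f).sum := by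
  induction L with
  | nil => rfl
  | cons i L ih => cases hi : p i <;> simp [hi, ih, h]

variable [DecidableEq ρ]

/-- The algorithm fails on `Q`, or computes its probability in time polynomial in the domain size,
with the maximal arity as exponent. -/
def Implementation.Settled (S : Implementation ρ) (Q : CNF ρ) : Prop :=
  Settles Q.maxArity (fun d _ P => lift S d Q P) (fun _ P => Pr P Q)

variable {S : Implementation ρ} {Q : CNF ρ} {U : List (CNF ρ)}

theorem IsUnionCNF.models_disjunction_union {n : ℕ} (hn : 1 ≤ n) {simplify : CNF ρ → CNF ρ}
    (hs : ∀ Q, IsSimplification Q (simplify Q)) (hU : IsUnionCNF simplify Q U)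
    {p : List (CNF ρ) × List (CNF ρ)} (hp : U.Perm (p.1 ++ p.2)) :
    models n Q = models n (disjunction p.1) ∪ models n (disjunction p.2) := by
  have : Nonempty (Fin n) := ⟨⟨0, hn⟩⟩
  ext I
  simp only [Set.mem_union, mem_models, hU.holds_iff hs, holds_disjunction, hp.mem_iff,
    List.mem_append, or_and_right, exists_or]

theorem IsUnionCNF.models_eq_iUnion {n : ℕ} (hn : 1 ≤ n) {simplify : CNF ρ → CNF ρ}
    (hs : ∀ Q, IsSimplification Q (simplify Q)) (hU : IsUnionCNF simplify Q U) :
    models n Q = ⋃ i : Fin U.length, models n (U.get i) := by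
  have : Nonempty (Fin n) := ⟨⟨0, hn⟩⟩
  ext I
  simp only [Set.mem_iUnion, mem_models, hU.holds_iff hs, List.exists_mem_iff_get]

theorem settled_of_symbols_ssubset
    (ih : ∀ Q' : CNF ρ, Q'.RepetitionFree → Q'.rank < Q.rank → S.Settled Q') {Q' : CNF ρ}
    (hQ' : Q'.RepetitionFree) (h : Q'.symbols ⊂ Q.symbols) :
    Settles Q.maxArity (fun d _ P => lift S d Q' P) (fun _ P => Pr P Q') :=
  (ih Q' hQ' (CNF.rank_lt_of_symbols_ssubset h)).mono (CNF.maxArity_mono h.1)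

theorem settles_decomposable_disjunction (hU : IsUnionCNF S.simplify Q U) (hlen : 1 < U.length)
    (hQ : Q.RepetitionFree) {p : List (CNF ρ) × List (CNF ρ)} (hp : IsUnionPartition U p)
    (ih : ∀ Q' : CNF ρ, Q'.RepetitionFree → Q'.rank < Q.rank → S.Settled Q') :
    Settles Q.maxArity
      (fun d _ P => (lift S d (disjunction p.1) P).bind fun x =>
        (lift S d (disjunction p.2) P).bind fun y => .value (1 - (1 - x) * (1 - y)) 4)
      (fun _ P => Pr P Q) := by
  obtain ⟨hne₁, hne₂, hperm, hdisjoint⟩ := hp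
  have hmem₁ (q : CNF ρ) (hq : q ∈ p.1) : q ∈ U := hperm.mem_iff.2 (List.mem_append_left _ hq)
  have hmem₂ (q : CNF ρ) (hq : q ∈ p.2) : q ∈ U := hperm.mem_iff.2 (List.mem_append_right _ hq)
  have hfree := hU.repetitionFree S.simplify_spec hQ
  have hsubset (q : CNF ρ) (hq : q ∈ U) : q.symbols ⊆ Q.symbols :=
    (hU.isBoundedBy S.simplify_spec q hq).symbols_subset
  obtain ⟨q₁, hq₁⟩ := List.exists_mem_of_ne_nil _ hne₁
  obtain ⟨q₂, hq₂⟩ := List.exists_mem_of_ne_nil _ hne₂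
  have hsub₁ : (disjunction p.1).symbols ⊂ Q.symbols :=
    symbols_disjunction_ssubset (fun q hq => hsubset q (hmem₁ q hq)) (hsubset q₂ (hmem₂ q₂ hq₂))
      (hU.symbols_nonempty hlen (hmem₂ q₂ hq₂)) fun q hq => hdisjoint q hq q₂ hq₂
  have hsub₂ : (disjunction p.2).symbols ⊂ Q.symbols :=
    symbols_disjunction_ssubset (fun q hq => hsubset q (hmem₂ q hq)) (hsubset q₁ (hmem₁ q₁ hq₁))
      (hU.symbols_nonempty hlen (hmem₁ q₁ hq₁)) fun q hq => (hdisjoint q₁ hq₁ q hq).symm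
  have h₁ := settled_of_symbols_ssubset ih (.disjunction fun q hq => hfree q (hmem₁ q hq)) hsub₁
  have h₂ := settled_of_symbols_ssubset ih (.disjunction fun q hq => hfree q (hmem₂ q hq)) hsub₂
  refine (h₁.bind (h₂.bind (settles_value _ _ 4))).congr fun n hn P => ?_
  exact (Pr_of_models_eq_union P (disjoint_symbols_disjunction hdisjoint)
    (hU.models_disjunction_union hn S.simplify_spec hperm)).symm

/-- The terms are strictly stronger than `Q`, as no member of an irredundant union is equivalent to
the whole union. -/
theorem settled_of_mem_terms (hU : IsUnionCNF S.simplify Q U) (hlen : 1 < U.length)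
    (hQ : Q.RepetitionFree) {T : List (CNF ρ)} (hT : IsTermList U T)
    (ih : ∀ Q' : CNF ρ, Q'.RepetitionFree → Q'.rank < Q.rank → S.Settled Q') {q : CNF ρ}
    (hq : q ∈ T) : Settles Q.maxArity (fun d _ P => lift S d q P) (fun _ P => Pr P q) := by
  obtain ⟨s, ⟨i, hi⟩, rfl⟩ := hT.1 q hq
  have hmem := List.get_mem U i
  have hbound := CNF.IsBoundedBy.conjunction (hU.isBoundedBy S.simplify_spec) s
  have hstronger := conjunction_entails hi
  refine (ih _ (.conjunction (hU.repetitionFree S.simplify_spec hQ) s) (hbound.rank_lt ?_ ?_)).mono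
    (CNF.maxArity_mono hbound.symbols_subset)
  · exact hstronger.trans (hU.entails S.simplify_spec _ hmem)
  · exact fun h => hU.not_entails S.simplify_spec hlen hmem (h.trans hstronger)

theorem settles_inclusion_exclusion (hU : IsUnionCNF S.simplify Q U) (hlen : 1 < U.length)
    (hQ : Q.RepetitionFree) {T : List (CNF ρ)} (hT : IsTermList U T)
    (ih : ∀ Q' : CNF ρ, Q'.RepetitionFree → Q'.rank < Q.rank → S.Settled Q') :
    Settles Q.maxArity
      (fun d _ P => Outcome.fold (· + ·) 0
        ((T.filter fun q => coefficient U q ≠ 0).map fun q =>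
          (lift S d q P).bind fun x => .value (coefficient U q * x) 1))
      (fun _ P => Pr P Q) := by
  refine (settles_fold (· + ·) 0 fun q hq => (settled_of_mem_terms hU hlen hQ hT ih
    (List.mem_of_mem_filter hq)).bind (settles_value _ _ 1)).congr fun n hn P => ?_
  rw [Pr_eq_sum_terms hn P (hU.models_eq_iUnion hn S.simplify_spec) hT, ← List.sum]
  refine sum_map_filter_eq (fun q hq => ?_) T
  have hcoefficient : coefficient U q = 0 := by simpa using hq
  simp only [hcoefficient, Int.cast_zero, zero_mul]

theorem settles_decomposable_conjunction (hQ : Q.RepetitionFree) (hemp : ∅ ∉ Q) {p : CNF ρ × CNF ρ}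
    (hp : IsClausePartition Q p)
    (ih : ∀ Q' : CNF ρ, Q'.RepetitionFree → Q'.rank < Q.rank → S.Settled Q') :
    Settles Q.maxArity
      (fun d _ P => (lift S d p.1 P).bind fun x => (lift S d p.2 P).bind fun y => .value (x * y) 1)
      (fun _ P => Pr P Q) := by
  obtain ⟨hne₁, hne₂, rfl, hdisjoint⟩ := hp
  rw [Finset.mem_union, not_or] at hemp
  obtain ⟨s₁, hs₁⟩ := CNF.symbols_nonempty hne₁.ne_empty hemp.1
  obtain ⟨s₂, hs₂⟩ := CNF.symbols_nonempty hne₂.ne_empty hemp.2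
  have hsub₁ : p.1.symbols ⊂ (p.1 ∪ p.2).symbols := by
    rw [CNF.symbols_union, Finset.ssubset_iff_of_subset Finset.subset_union_left]
    exact ⟨s₂, Finset.mem_union_right _ hs₂, Finset.disjoint_right.1 hdisjoint hs₂⟩
  have hsub₂ : p.2.symbols ⊂ (p.1 ∪ p.2).symbols := by
    rw [CNF.symbols_union, Finset.ssubset_iff_of_subset Finset.subset_union_right]
    exact ⟨s₁, Finset.mem_union_left _ hs₁, Finset.disjoint_left.1 hdisjoint hs₁⟩
  have h₁ := settled_of_symbols_ssubset ih (hQ.mono Finset.subset_union_left) hsub₁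
  have h₂ := settled_of_symbols_ssubset ih (hQ.mono Finset.subset_union_right) hsub₂
  exact (h₁.bind (h₂.bind (settles_value _ _ 1))).congr fun n _ P =>
    (Pr_union_of_disjoint P hdisjoint).symm

theorem settles_separator (hQ : Q.RepetitionFree) (hne : Q ≠ ∅) (hemp : ∅ ∉ Q)
    {sep : (Clause ρ → ℕ) × (ρ → ℕ → ℕ)} (hsep : IsSeparator Q sep)
    (ih : ∀ Q' : CNF ρ, Q'.RepetitionFree → Q'.rank < Q.rank → S.Settled Q') :
    Settles Q.maxArity
      (fun d n P => Outcome.fold (· * ·) 1 ((List.finRange n).map fun a =>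
        lift S d (Q.instantiate sep.2) (P.restrict sep.2 a)))
      (fun _ P => Pr P Q) := by
  have harity := hsep.maxArity_instantiate_lt (CNF.symbols_nonempty hne hemp)
  have hrank := CNF.rank_lt_of_add_lt
    (add_lt_add_of_lt_of_le harity hsep.card_symbols_instantiate_le)
  exact (((ih _ (hQ.instantiate sep.2) hrank).prod_restrict sep.2).mono harity).congr
    fun n _ P => (Pr_separator P hQ hsep).symm

theorem settled_of_forall_rank_lt (hQ : Q.RepetitionFree)
    (ih : ∀ Q' : CNF ρ, Q'.RepetitionFree → Q'.rank < Q.rank → S.Settled Q') : S.Settled Q := by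
  have hs := S.simplify_spec Q
  have hR := hs.repetitionFree hQ
  have hbound := hs.isBoundedBy Q.isBoundedBy_self
  replace ih (Q' : CNF ρ) (hQ' : Q'.RepetitionFree) (h : Q'.rank < (S.simplify Q).rank) :
      S.Settled Q' := ih Q' hQ' (h.trans_le (hbound.rank_le hs.1.2))
  suffices h : Settles (S.simplify Q).maxArity (fun d _ P => lift S (d + 1) Q P)
      (fun _ P => Pr P (S.simplify Q)) from
    .of_succ ((h.mono (CNF.maxArity_mono hbound.symbols_subset)).congr fun n hn P =>
      (Pr_congr hn P hs.1).symm)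
  have hU := S.union_spec (S.simplify Q)
  simp only [lift]
  refine Settles.delay ?_ _
  split_ifs with hne hemp hlit hlen hpart hpart hsep
  · exact (settles_value _ _ 0).congr fun n _ P => by rw [hne, Pr_empty]
  · exact (settles_value _ _ 0).congr fun n hn P => (Pr_of_empty_mem hn P hemp).symm
  · refine (settles_value _ _ 2).congr fun n hn P => ?_
    obtain ⟨hQl, hargs⟩ := hlit.choose_spec
    rw [← Pr_literal hn P hargs, ← hQl]
  · exact settles_decomposable_disjunction hU hlen hR (S.unionPartition_spec _ hpart) ih
  · exact settles_inclusion_exclusion hU hlen hR (S.terms_spec _) ih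
  · exact settles_decomposable_conjunction hR hemp (S.clausePartition_spec _ hpart) ih
  · exact settles_separator hR hne hemp (S.separator_spec _ hsep) ih
  · exact settles_fail _ 0 _

theorem CNF.RepetitionFree.settled (S : Implementation ρ) (hQ : Q.RepetitionFree) :
    S.Settled Q := by
  induction hr : Q.rank using WellFoundedLT.induction generalizing Q with
  | ind r ih =>
    exact settled_of_forall_rank_lt hQ fun Q' hQ' hlt => ih _ (hr ▸ hlt) hQ' rfl

end Algorithm

end LiftR

theorem mainTheorem1_general {ρ : Type*} [DecidableEq ρ] (S : LiftR.Implementation ρ)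
    (Q : LiftR.CNF ρ) (hQ : Q.RepetitionFree) :
    LiftR.FailsOn S Q ∨
      ∃ c : ℕ, ∀ n : ℕ, 1 ≤ n → ∀ P : LiftR.PDB ρ n,
        ∃ t : ℕ, LiftR.Computes S Q P (LiftR.Pr P Q) t ∧ t ≤ c * n ^ Q.maxArity := by
  rcases hQ.settled S with hfails | ⟨c, hreturns⟩
  · obtain ⟨d, h⟩ := hfails.exists
    exact .inl fun n hn P => ⟨d, h n hn P⟩
  · obtain ⟨d, h⟩ := hreturns.exists
    refine .inr ⟨c, fun n hn P => ?_⟩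
    obtain ⟨t, ht, hle⟩ := h n hn P
    exact ⟨t, ⟨d, ht⟩, hle⟩

theorem mainTheorem1 {ρ : Type*} [DecidableEq ρ] (S : LiftR.Implementation ρ)
    (Q : LiftR.CNF ρ) (hQ : Q.Ranked) :
    LiftR.FailsOn S Q ∨
      ∃ c : ℕ, ∀ n : ℕ, 1 ≤ n → ∀ P : LiftR.PDB ρ n,
        ∃ t : ℕ, LiftR.Computes S Q P (LiftR.Pr P Q) t ∧ t ≤ c * n ^ Q.maxArity :=
  mainTheorem1_general S Q hQ.repetitionFree
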